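/- Let $Q$ be a smooth $n$-dimensional manifold and $k\in\mathbb N$; sums over repeated indices are understood, $\alpha=1,\dots,k$, $i=1,\dots,n$. On $\oplus^k\mathrm T^*Q\times\mathbb R^k$ put $\eta^\alpha=\mathrm ds^\alpha-\theta^\alpha$, where $(s^\alpha)$ are the coordinates of $\mathbb R^k$ and $\theta^\alpha$ is the pull-back of the Liouville form of $\mathrm T^*Q$ by the projection to the $\alpha$-th summand; in natural coordinates $\eta^\alpha=\mathrm ds^\alpha-p_i^\alpha\,\mathrm dq^i$. Let $\mathcal W=\oplus^k\mathrm TQ\times_Q\oplus^k\mathrm T^*Q\times\mathbb R^k$ with projections $\rho_1:\mathcal W\to\oplus^k\mathrm TQ\times\mathbb R^k$ and $\rho_2:\mathcal W\to\oplus^k\mathrm T^*Q\times\mathbb R^k$, and denote also by $\eta^\alpha=\mathrm ds^\alpha-\rho_2^*\theta^\alpha$ the contact $1$-forms on $\mathcal W$. A family of Reeb vector fields is a family $(\mathcal R_\alpha)$ with $i(\mathcal R_\alpha)\eta^\beta=\delta_\alpha^\beta$ and $i(\mathcal R_\alpha)\mathrm d\eta^\beta=0$ (it is unique on $\oplus^k\mathrm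 T^*Q\times\mathbb R^k$, but not on $\mathcal W$). Let $L:\oplus^k\mathrm TQ\times\mathbb R^k\to\mathbb R$ be smooth. Let $\mathcal FL:\oplus^k\mathrm TQ\times\mathbb R^k\to\oplus^k\mathrm T^*Q\times\mathbb R^k$ be its Legendre map (fibre derivative), $\mathcal FL(q^i,v^i_\alpha,s^\alpha)=(q^i,\partial L/\partial v^i_\alpha,s^\alpha)$; let $E_L=v^i_\alpha\,\partial L/\partial v^i_\alpha-L$ be its energy, let $\mathcal H=\mathcal C-L\circ\rho_1$ on $\mathcal W$, where $\mathcal C=p_i^\alpha v^i_\alpha$ is the coupling function, and let $\mathcal W_1=\{w\in\mathcal W:\rho_2(w)=\mathcal FL(\rho_1(w))\}$. Assume that $L$ is regular, i.e. $\mathcal FL$ is a local diffeomorphism. Let $(\mathcal R_\alpha)$ be any family of Reeb vector fields on $\mathcal W$ and let $\mathbf Z=(Z_1,\dots,Z_k)$ be a $k$-vector field on $\mathcal W$ which, at the points of $\mathcal W_1$, is a solution of the Skinner–Rusk equations $$i(Z_\alpha)\mathrm d\eta^\alpha=\mathrm d\mathcal H-(\mathcal L_{\mathcal R_\alpha}\mathcal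 H)\eta^\alpha,\qquad i(Z_\alpha)\eta^\alpha=-\mathcal H .$$ Let $D\subseteq\mathbb R^k$ be open (for instance $D=\mathbb R^k$) and let $\psi:D\to\mathcal W_1\subset\mathcal W$ be a smooth integral section of $\mathbf Z$, i.e. $\mathrm T\psi\circ\partial/\partial t^\alpha=Z_\alpha\circ\psi$ for every $\alpha$. Put $\psi_L=\rho_1\circ\psi$ and $\psi_H=\rho_2\circ\psi=\mathcal FL\circ\psi_L$. Then: 1. (Existence of the local Hamiltonian.) Every point of $\oplus^k\mathrm TQ\times\mathbb R^k$ has an open neighbourhood $U$ such that $\mathcal FL|_U$ is injective, $\mathcal FL(U)$ is open, and there is a smooth function $H$ on $\mathcal FL(U)$ with $E_L=H\circ\mathcal FL$ on $U$. 2. For every open $U\subseteq\oplus^k\mathrm TQ\times\mathbb R^k$ and every smooth function $H$ on $\mathcal FL(U)$ with $E_L=H\circ\mathcal FL$ on $U$, the map $\psi_H$ is, on the open set $V=\psi_L^{-1}(U)\subseteq D$, a smooth solution of the $k$-contact Hamilton–De Donder–Weyl equations of $H$, $$i\big((\psi_H)'_\alpha\big)\mathrm d\eta^\alpha=\big(\mathrm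 dH-(\mathcal L_{\mathcal R_\alpha}H)\eta^\alpha\big)\circ\psi_H,\qquad i\big((\psi_H)'_\alpha\big)\eta^\alpha=-H\circ\psi_H,$$ where $(\psi_H)'_\alpha=\mathrm T\psi_H(\partial/\partial t^\alpha)$ and $\mathcal R_\alpha$ are here the Reeb vector fields of $\oplus^k\mathrm T^*Q\times\mathbb R^k$; moreover, in the natural coordinates $(q^i,p_i^\alpha,s^\alpha)$ induced by any chart of $Q$, writing $\psi_H(t)=(q^i(t),p_i^\alpha(t),s^\alpha(t))$, $$\frac{\partial q^i}{\partial t^\alpha}=\frac{\partial H}{\partial p_i^\alpha}\circ\psi_H,\qquad \frac{\partial p_i^\alpha}{\partial t^\alpha}=-\Big(\frac{\partial H}{\partial q^i}+p_i^\alpha\frac{\partial H}{\partial s^\alpha}\Big)\circ\psi_H,\qquad \frac{\partial s^\alpha}{\partial t^\alpha}=\Big(p_i^\alpha\frac{\partial H}{\partial p_i^\alpha}-H\Big)\circ\psi_H .$$ -/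

import Mathlib

open Set Bundle
open scoped Manifold ContDiff Bundle

noncomputable section

namespace KContact

/-- The Euclidean space `ℝᵐ`. -/
abbrev R (m : ℕ) : Type := EuclideanSpace ℝ (Fin m)

/-- The standard basis vectors `∂/∂t^a` of `ℝᵐ`. -/
def basisVec {m : ℕ} (a : Fin m) : R m := EuclideanSpace.single a (1 : ℝ)

/-! ### Differential forms and `k`-contact Hamiltonian equations on a manifold -/

section General

variable {E : Type*} [NormedAddCommGroup E] [NormedSpace ℝ E]
  {H : Type*} [TopologicalSpace H] (I : ModelWithCorners ℝ E H)
  {M : Type*} [TopologicalSpace M] [ChartedSpace H M]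

/-- (Not necessarily smooth) vector fields on `M`. -/
abbrev VField (M : Type*) [TopologicalSpace M] [ChartedSpace H M] : Type _ :=
  (x : M) → TangentSpace I x

/-- (Not necessarily smooth) differential 1-forms on `M`. -/
abbrev OneForm (M : Type*) [TopologicalSpace M] [ChartedSpace H M] : Type _ :=
  (x : M) → (TangentSpace I x →L[ℝ] ℝ)

/-- The expression `(φ⁻¹)^* η` of a 1-form `η` in the chart `φ` of `M` around `x₀`, as a 1-form on
the model vector space. -/
def OneForm.inChart (η : OneForm I M) (x₀ : M) (y : E) : E [⋀^Fin 1]→L[ℝ] ℝ :=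
  ContinuousAlternatingMap.ofSubsingleton ℝ E ℝ 0
    ((η ((extChartAt I x₀).symm y)).comp (mfderiv 𝓘(ℝ, E) I (extChartAt I x₀).symm y))

/-- The exterior derivative `dη` of a 1-form on a manifold without boundary, evaluated at the
tangent vectors `u, v` at `x`; it is computed in the chart around `x`, with the convention
`dη(X,Y) = X(η(Y)) - Y(η(X)) - η([X,Y])`. -/
def OneForm.d (η : OneForm I M) (x : M) (u v : TangentSpace I x) : ℝ :=
  extDeriv (OneForm.inChart I η x) (extChartAt I x x)
    ![mvfderiv I (extChartAt I x) x u, mvfderiv I (extChartAt I x) x v]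

variable {k : ℕ}

/-- `𝓡₁, …, 𝓡ₖ` is a family of Reeb vector fields for the 1-forms `η¹, …, ηᵏ`:
`i(𝓡_α) η^β = δ_α^β` and `i(𝓡_α) dη^β = 0`. -/
structure IsReebFamily (η : Fin k → OneForm I M) (Rb : Fin k → VField I M) : Prop where
  contract : ∀ (x : M) (α β : Fin k), η β x (Rb α x) = if α = β then 1 else 0
  contract_d : ∀ (x : M) (α β : Fin k) (u : TangentSpace I x),
    OneForm.d I (η β) x (Rb α x) u = 0

/-- The `k` tangent vectors `X₁, …, Xₖ` at the point `x` satisfy the `k`-contact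
Hamilton–De Donder–Weyl equations of the Hamiltonian `h`, where `Rb` is the family of Reeb vector
fields used:
`i(X_α) dη^α = dh - (𝓡_α h) η^α` and `i(X_α) η^α = -h` (sums over `α`). -/
structure HDWAt (η : Fin k → OneForm I M) (Rb : Fin k → VField I M) (h : M → ℝ)
    (x : M) (X : Fin k → TangentSpace I x) : Prop where
  first : ∀ u : TangentSpace I x,
    ∑ α, OneForm.d I (η α) x (X α) u =
      mvfderiv I h x u - ∑ α, mvfderiv I h x (Rb α x) * η α x u
  second : ∑ α, η α x (X α) = - h x

/-- `ψ'_α(t)`, the image of `∂/∂t^α` under the tangent map of `ψ : ℝᵏ → M` at `t`. -/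
def partialVel (ψ : R k → M) (t : R k) (α : Fin k) : TangentSpace I (ψ t) :=
  mfderiv 𝓘(ℝ, R k) I ψ t (basisVec α : R k)

/-- `ψ : D ⊆ ℝᵏ → M` is a (smooth) integral section of the `k`-vector field `Z = (Z₁, …, Zₖ)`. -/
structure IsIntegralSection (Z : Fin k → VField I M) (ψ : R k → M) (D : Set (R k)) : Prop where
  smooth : ContMDiffOn 𝓘(ℝ, R k) I ∞ ψ D
  velocity : ∀ t ∈ D, ∀ α, partialVel I ψ t α = Z α (ψ t)

end General

/-! ### The bundles `⊕ᵏTQ × ℝᵏ`, `⊕ᵏT*Q × ℝᵏ` and the extended Pontryagin bundle -/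

section Bundles

variable (n k : ℕ) (Q : Type*) [TopologicalSpace Q] [ChartedSpace (R n) Q]

/-- The fibre `⊕ᵏ T_qQ`. A tuple `(v₁, …, vₖ)` of tangent vectors is encoded as the linear map
`v : ℝᵏ → T_qQ` with `v(e_α) = v_α`. -/
abbrev Vel (q : Q) : Type := Trivial Q (R k) q →L[ℝ] TangentSpace (𝓡 n) q

/-- The fibre `⊕ᵏ T*_qQ`. A tuple `(p¹, …, pᵏ)` of covectors is encoded as the linear map
`p : T_qQ → ℝᵏ` whose components are the `p^α`. -/
abbrev Mom (q : Q) : Type := TangentSpace (𝓡 n) q →L[ℝ] Trivial Q (R k) q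

variable [IsManifold (𝓡 n) ∞ Q]

/-- `⊕ᵏTQ × ℝᵏ` -/
abbrev LagSpace : Type _ := TotalSpace (R k →L[ℝ] R n) (Vel n k Q) × R k

/-- `⊕ᵏT*Q × ℝᵏ` -/
abbrev HamSpace : Type _ := TotalSpace (R n →L[ℝ] R k) (Mom n k Q) × R k

/-- The extended Pontryagin bundle `𝓦 = ⊕ᵏTQ ×_Q ⊕ᵏT*Q × ℝᵏ`. -/
abbrev Pontryagin : Type _ :=
  TotalSpace ((R k →L[ℝ] R n) × (R n →L[ℝ] R k)) (Vel n k Q ×ᵇ Mom n k Q) × R k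

/-- Model with corners of `⊕ᵏTQ × ℝᵏ`. -/
abbrev lagModel := ((𝓡 n).prod 𝓘(ℝ, R k →L[ℝ] R n)).prod 𝓘(ℝ, R k)

/-- Model with corners of `⊕ᵏT*Q × ℝᵏ`. -/
abbrev hamModel := ((𝓡 n).prod 𝓘(ℝ, R n →L[ℝ] R k)).prod 𝓘(ℝ, R k)

/-- Model with corners of `𝓦`. -/
abbrev pontModel :=
  ((𝓡 n).prod 𝓘(ℝ, (R k →L[ℝ] R n) × (R n →L[ℝ] R k))).prod 𝓘(ℝ, R k)

end Bundles

section Structures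

variable {n k : ℕ} {Q : Type*} [TopologicalSpace Q] [ChartedSpace (R n) Q]
  [IsManifold (𝓡 n) ∞ Q]

/-- The projection `ρ₁ : 𝓦 → ⊕ᵏTQ × ℝᵏ`. -/
def rho1 (w : Pontryagin n k Q) : LagSpace n k Q := (⟨w.1.proj, w.1.snd.1⟩, w.2)

/-- The projection `ρ₂ : 𝓦 → ⊕ᵏT*Q × ℝᵏ`. -/
def rho2 (w : Pontryagin n k Q) : HamSpace n k Q := (⟨w.1.proj, w.1.snd.2⟩, w.2)

/-- The canonical 1-forms `θ^α` on `⊕ᵏT*Q × ℝᵏ`: `θ^α_{(q,p,s)}(u) = p^α(Tπ(u))`, where `π` is the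
projection to `Q`. -/
def theta (α : Fin k) : OneForm (hamModel n k) (HamSpace n k Q) := fun z =>
  (EuclideanSpace.proj α : R k →L[ℝ] ℝ) ∘L z.1.snd ∘L
    mfderiv (hamModel n k) (𝓡 n) (fun z' : HamSpace n k Q => z'.1.proj) z

/-- The canonical `k`-contact structure `η^α = ds^α - θ^α` on `⊕ᵏT*Q × ℝᵏ`. -/
def etaHam (α : Fin k) : OneForm (hamModel n k) (HamSpace n k Q) := fun z =>
  mvfderiv (hamModel n k) (fun z' : HamSpace n k Q => z'.2 α) z - theta α z

/-- The canonical 1-forms `Θ^α = ρ₂^* θ^α` on `𝓦`. -/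
def ThetaPont (α : Fin k) : OneForm (pontModel n k) (Pontryagin n k Q) := fun w =>
  theta α (rho2 w) ∘L mfderiv (pontModel n k) (hamModel n k) rho2 w

/-- The contact 1-forms `η^α = ds^α - Θ^α` on `𝓦`. -/
def etaPont (α : Fin k) : OneForm (pontModel n k) (Pontryagin n k Q) := fun w =>
  mvfderiv (pontModel n k) (fun w' : Pontryagin n k Q => w'.2 α) w - ThetaPont α w

/-- The coupling function `𝓒(v, p, s) = p^α(v_α)` on `𝓦`. -/
def coupling (w : Pontryagin n k Q) : ℝ :=
  ∑ α, (w.1.snd.2 (w.1.snd.1 (basisVec α : R k)) : R k) α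

/-- The Hamiltonian function `𝓗 = 𝓒 - ρ₁^* L` on `𝓦`. -/
def pontHamiltonian (L : LagSpace n k Q → ℝ) (w : Pontryagin n k Q) : ℝ :=
  coupling w - L (rho1 w)

/-- The derivative of `L` along the fibre of `⊕ᵏTQ × ℝᵏ → Q × ℝᵏ`, at `(q, v, s)`. -/
def fibreDeriv (L : LagSpace n k Q → ℝ) (x : LagSpace n k Q) : Vel n k Q x.1.proj →L[ℝ] ℝ :=
  fderiv ℝ (fun v : Vel n k Q x.1.proj => L (⟨x.1.proj, v⟩, x.2)) x.1.snd

/-- The inclusion `u ↦ (0, …, u, …, 0)` of `T_qQ` as the `α`-th summand of `⊕ᵏ T_qQ`. -/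
def inclVel (q : Q) (α : Fin k) : TangentSpace (𝓡 n) q →L[ℝ] Vel n k Q q where
  toFun u := (EuclideanSpace.proj α : R k →L[ℝ] ℝ).smulRight u
  map_add' u v := by ext x; simp
  map_smul' c u := by ext x; simp [smul_comm c]
  cont := (ContinuousLinearMap.smulRightL ℝ (R k) (R n)
    (EuclideanSpace.proj α : R k →L[ℝ] ℝ)).continuous

/-- The Legendre map `𝓕L : ⊕ᵏTQ × ℝᵏ → ⊕ᵏT*Q × ℝᵏ`, the fibre derivative of `L`:
`𝓕L(q, v, s) = (q, p, s)` with `p^α(u) = d/dτ|₀ L(q, (v₁, …, v_α + τ u, …, vₖ), s)`. -/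
def legendre (L : LagSpace n k Q → ℝ) (x : LagSpace n k Q) : HamSpace n k Q :=
  (⟨x.1.proj, ∑ α, (fibreDeriv L x ∘L inclVel x.1.proj α).smulRight (basisVec α : R k)⟩, x.2)

/-- The Lagrangian energy `E_L = Δ(L) - L`, where `Δ` is the Liouville vector field
`v^i_α ∂/∂v^i_α`. -/
def lagEnergy (L : LagSpace n k Q → ℝ) (x : LagSpace n k Q) : ℝ :=
  fibreDeriv L x x.1.snd - L x

/-- `L` is regular: its Legendre map is a local diffeomorphism. -/
def IsRegularLagrangian (L : LagSpace n k Q → ℝ) : Prop :=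
  IsLocalDiffeomorph (lagModel n k) (hamModel n k) ∞ (legendre L)

/-- The first constraint submanifold `𝓦₁`, the graph of the Legendre map:
`𝓦₁ = {w | ρ₂(w) = 𝓕L(ρ₁(w))}`. -/
def firstConstraint (L : LagSpace n k Q → ℝ) : Set (Pontryagin n k Q) :=
  {w | rho2 w = legendre L (rho1 w)}

/-! ### Natural coordinates on `⊕ᵏT*Q × ℝᵏ` -/

/-- The coordinate space with coordinates `(q^i, p_i^α, s^α)`. -/
abbrev Coords (n k : ℕ) : Type := (Fin n → ℝ) × (Fin k → Fin n → ℝ) × (Fin k → ℝ)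

/-- The natural coordinates `(q^i, p_i^α, s^α)` on `⊕ᵏT*Q × ℝᵏ` induced by a chart `e` of `Q`:
`p_i^α = p^α(∂/∂q^i)`. -/
def natCoords (e : OpenPartialHomeomorph Q (R n)) (z : HamSpace n k Q) : Coords n k :=
  (fun i => e z.1.proj i,
   fun α i => (z.1.snd ((mvfderiv (𝓡 n) e z.1.proj).inverse (basisVec i : R n)) : R k) α,
   fun α => z.2 α)

/-- The point of `⊕ᵏT*Q × ℝᵏ` with natural coordinates `(q^i, p_i^α, s^α)`:
`p^α = p_i^α dq^i`. -/
def natPoint (e : OpenPartialHomeomorph Q (R n)) (c : Coords n k) : HamSpace n k Q :=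
  (⟨e.symm (WithLp.toLp 2 c.1),
    ∑ α, ∑ i, c.2.1 α i •
      ((EuclideanSpace.proj i : R n →L[ℝ] ℝ) ∘L
        mvfderiv (𝓡 n) e (e.symm (WithLp.toLp 2 c.1))).smulRight (basisVec α : R k)⟩,
   WithLp.toLp 2 c.2.2)

/-- The coordinate vector `∂/∂q^i` of the coordinate space. -/
def dirQ (k : ℕ) {n : ℕ} (i : Fin n) : Coords n k := (Pi.single i 1, 0, 0)

/-- The coordinate vector `∂/∂p_i^α` of the coordinate space. -/
def dirP {n k : ℕ} (i : Fin n) (α : Fin k) : Coords n k :=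
  (0, Pi.single α (Pi.single i 1), 0)

/-- The coordinate vector `∂/∂s^α` of the coordinate space. -/
def dirS (n : ℕ) {k : ℕ} (α : Fin k) : Coords n k := (0, 0, Pi.single α 1)

/-- The map `φ : ℝᵏ → ⊕ᵏT*Q × ℝᵏ` satisfies at `t` the `k`-contact Hamilton field equations of the
Hamiltonian `h` in the natural coordinates induced by the chart `e` of `Q`:
`∂q^i/∂t^α = ∂h/∂p_i^α`, `∂p_i^α/∂t^α = -(∂h/∂q^i + p_i^α ∂h/∂s^α)`,
`∂s^α/∂t^α = p_i^α ∂h/∂p_i^α - h` (sums over repeated indices). -/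
structure HDWCoordsAt (e : OpenPartialHomeomorph Q (R n)) (h : HamSpace n k Q → ℝ)
    (φ : R k → HamSpace n k Q) (t : R k) : Prop where
  eq_q : ∀ (i : Fin n) (α : Fin k),
    fderiv ℝ (fun τ => (natCoords e (φ τ)).1 i) t (basisVec α) =
      fderiv ℝ (fun c => h (natPoint e c)) (natCoords e (φ t)) (dirP i α)
  eq_p : ∀ i : Fin n,
    ∑ α, fderiv ℝ (fun τ => (natCoords e (φ τ)).2.1 α i) t (basisVec α) =
      -(fderiv ℝ (fun c => h (natPoint e c)) (natCoords e (φ t)) (dirQ k i) +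
        ∑ α, (natCoords e (φ t)).2.1 α i *
          fderiv ℝ (fun c => h (natPoint e c)) (natCoords e (φ t)) (dirS n α))
  eq_s :
    ∑ α, fderiv ℝ (fun τ => (natCoords e (φ τ)).2.2 α) t (basisVec α) =
      (∑ α, ∑ i, (natCoords e (φ t)).2.1 α i *
        fderiv ℝ (fun c => h (natPoint e c)) (natCoords e (φ t)) (dirP i α)) - h (φ t)

/-- On the open set `V ⊆ ℝᵏ`, the smooth map `φ` is a solution of the `k`-contact
Hamilton–De Donder–Weyl equations of the Hamiltonian `h` on the canonical `k`-contact manifold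
`⊕ᵏT*Q × ℝᵏ`, whose Reeb vector fields exist and are unique. The equations hold in their
intrinsic form and in the natural (Darboux) coordinates induced by every chart of `Q`. -/
structure IsHDWSolutionOn (h : HamSpace n k Q → ℝ) (φ : R k → HamSpace n k Q)
    (V : Set (R k)) : Prop where
  smooth : ContMDiffOn 𝓘(ℝ, R k) (hamModel n k) ∞ φ V
  intrinsic : ∃ Rb : Fin k → VField (hamModel n k) (HamSpace n k Q),
    IsReebFamily (hamModel n k) etaHam Rb ∧
      ∀ t ∈ V, HDWAt (hamModel n k) etaHam Rb h (φ t) (partialVel (hamModel n k) φ t)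
  coords : ∀ e ∈ IsManifold.maximalAtlas (𝓡 n) ∞ Q, ∀ t ∈ V, (φ t).1.proj ∈ e.source →
    HDWCoordsAt e h φ t

end Structures
end KContact
end

set_option linter.unusedSectionVars false

noncomputable section

namespace KContact

/-! The Skinner–Rusk equations at a point of `𝓦₁` are the pull-back by `ρ₂` of the Hamilton–De
Donder–Weyl equations of `h`, and `Tρ₂` is surjective, so the pull-back can be cancelled.

The contact forms and their differentials on `𝓦` are pulled back from `⊕ᵏT*Q × ℝᵏ` (`etaPont_apply`,
`d_etaPont`). A Reeb family on `𝓦` is determined only up to `ker Tρ₂`. Its projections still satisfy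
the Reeb conditions downstairs, where these have the single solution `∂/∂s^α`, so the projections do
not depend on the point of the fibre (`mfderiv_rho2_reeb`).

The remaining point is `d𝓗 = ρ₂^* dh` at points of `𝓦₁` (`mvfderiv_pontHamiltonian`). On `ker Tρ₂`,
spanned by the velocity directions, `d𝓗` vanishes because `∂𝓗/∂v = p - ∂L/∂v` is zero on `𝓦₁`. On
`𝓦₁`, the graph of `𝓕L`, one has `𝓗 = E_L = h ∘ 𝓕L = h ∘ ρ₂`, so both sides agree on tangent vectors
of the graph. Since `𝓕L` is a local diffeomorphism, `Tρ₂` maps the tangent space of the graph onto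
everything; hence that space and `ker Tρ₂` together span the tangent space of `𝓦`.

The coordinate equations follow by evaluating the intrinsic ones on coordinate vectors in natural
coordinates (`hdwCoordsAt_of_hdwAt`). The local Hamiltonian is `E_L` composed with a local inverse
of `𝓕L`. -/

theorem isManifold_one (n : ℕ) (Q : Type*) [TopologicalSpace Q] [ChartedSpace (R n) Q]
    [IsManifold (𝓡 n) ∞ Q] : IsManifold (𝓡 n) 1 Q :=
  IsManifold.of_le (n := ∞) (by simp)

attribute [local instance] isManifold_one

/-! ### Exterior derivatives of pulled-back 1-forms -/

section Pullback

variable {E : Type*} [NormedAddCommGroup E] [NormedSpace ℝ E]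
  {H : Type*} [TopologicalSpace H] {I : ModelWithCorners ℝ E H}
  {M : Type*} [TopologicalSpace M] [ChartedSpace H M]
  {E' : Type*} [NormedAddCommGroup E'] [NormedSpace ℝ E']

variable (E) in
/-- A continuous linear form as an alternating 1-form. -/
def linearForm : (E →L[ℝ] ℝ) ≃ₗᵢ[ℝ] (E [⋀^Fin 1]→L[ℝ] ℝ) :=
  ContinuousAlternatingMap.ofSubsingletonLIE (0 : Fin 1)

theorem linearForm_apply (f : E →L[ℝ] ℝ) (v : Fin 1 → E) : linearForm E f v = f (v 0) := rfl

theorem OneForm.inChart_eq (η : OneForm I M) (x₀ : M) (y : E) :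
    OneForm.inChart I η x₀ y =
      linearForm E ((η ((extChartAt I x₀).symm y)).comp
        (mfderiv 𝓘(ℝ, E) I (extChartAt I x₀).symm y)) := rfl

theorem mvfderiv_comp_extChartAt [IsManifold I ∞ M] {x : M} {F : E → E'}
    (hF : DifferentiableAt ℝ F (extChartAt I x x)) (u : TangentSpace I x) :
    mvfderiv I (fun y => F (extChartAt I x y)) x u
      = fderiv ℝ F (extChartAt I x x) (mvfderiv I (extChartAt I x) x u) := by
  have : IsManifold I 1 M := IsManifold.of_le (n := ∞) (by simp)
  have := mfderiv_comp_apply x (g := F) (f := extChartAt I x) (I := I) (I' := 𝓘(ℝ, E))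
    (I'' := 𝓘(ℝ, E')) hF.mdifferentiableAt (mdifferentiableAt_extChartAt (mem_chart_source H x)) u
  rw [mfderiv_eq_fderiv] at this
  exact this

/-- The exterior derivative of a 1-form which near `x` is the pull-back by `g` of a
1-form `θ` on a vector space. -/
theorem OneForm.d_of_eventuallyEq [I.Boundaryless] [IsManifold I ∞ M]
    (η : OneForm I M) {x : M} (θ : E' → E' →L[ℝ] ℝ) (g : M → E')
    (hθ : DifferentiableAt ℝ θ (g x))
    (hg : ContMDiffAt I 𝓘(ℝ, E') ∞ g x)
    (h : ∀ᶠ y in nhds x, η y = (θ (g y)).comp (mvfderiv I g y))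
    (u v : TangentSpace I x) :
    OneForm.d I η x u v = extDeriv (fun y => linearForm E' (θ y)) (g x)
        ![mvfderiv I g x u, mvfderiv I g x v] := by
  set φ := extChartAt I x with hφ
  have hx : φ.symm (φ x) = x := extChartAt_to_inv x
  set F : E → E' := g ∘ φ.symm with hF'
  have hFx : F (φ x) = g x := by simp [hF', hx]
  have hsymm : ContMDiffAt 𝓘(ℝ, E) I ∞ φ.symm (φ x) :=
    (contMDiffOn_extChartAt_symm x).contMDiffAt (extChartAt_target_mem_nhds x)
  have hFs : ContMDiffAt 𝓘(ℝ, E) 𝓘(ℝ, E') ∞ F (φ x) :=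
    ContMDiffAt.comp (φ x) (by rwa [hx]) hsymm
  have hF : ContDiffAt ℝ 2 F (φ x) := hFs.contDiffAt.of_le (WithTop.coe_le_coe.2 (le_top : (2 : ℕ∞) ≤ ⊤))
  have hF1 : DifferentiableAt ℝ F (φ x) := hF.differentiableAt two_ne_zero
  have hgF : (fun y => F (φ y)) =ᶠ[nhds x] g := by
    filter_upwards [extChartAt_source_mem_nhds (I := I) x] with y hy
    exact congrArg g ((extChartAt I x).left_inv hy)
  have hev : ∀ᶠ y in nhds x, MDifferentiableAt I 𝓘(ℝ, E') g y := by
    have hM : IsManifold I 1 M := IsManifold.of_le (n := ∞) (by simp)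
    filter_upwards [(contMDiffAt_iff_contMDiffAt_nhds (by simp)).1
      (hg.of_le (m := 1) (by simp))] with y hy
    exact hy.mdifferentiableAt one_ne_zero
  have hcont : Filter.Tendsto φ.symm (nhds (φ x)) (nhds x) := by
    have := hsymm.continuousAt
    rwa [ContinuousAt, hx] at this
  -- In the chart, `η` is the pull-back of `θ` by the local representative `F = g ∘ φ⁻¹`, a map
  -- between vector spaces.
  have key : OneForm.inChart I η x =ᶠ[nhds (φ x)] fun y =>
      (linearForm E' (θ (F y))).compContinuousLinearMap (fderiv ℝ F y) := by
    filter_upwards [hcont.eventually h, hcont.eventually hev,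
      extChartAt_target_mem_nhds (I := I) x] with y hy hy1 hyt
    have hd : MDifferentiableAt 𝓘(ℝ, E) I φ.symm y :=
      ((contMDiffOn_extChartAt_symm (n := ∞) x).contMDiffAt
        ((isOpen_extChartAt_target x).mem_nhds hyt)).mdifferentiableAt (by simp)
    have hc : fderiv ℝ F y = (mvfderiv I g (φ.symm y)).comp (mfderiv 𝓘(ℝ, E) I φ.symm y) := by
      rw [← mfderiv_eq_fderiv]
      exact mfderiv_comp y hy1 hd
    rw [OneForm.inChart_eq]
    rw [hy, hc]
    rfl
  have hθ' : DifferentiableAt ℝ (fun y => linearForm E' (θ y)) (F (φ x)) := by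
    rw [hFx]
    exact (linearForm E').differentiableAt.comp _ hθ
  have hm : ∀ u : TangentSpace I x, mvfderiv I g x u = fderiv ℝ F (φ x) (mvfderiv I φ x u) := by
    intro u
    rw [← mvfderiv_comp_extChartAt hF1]
    have := hgF.mfderiv_eq (I := I) (I' := 𝓘(ℝ, E'))
    exact (congrArg (fun A : E →L[ℝ] E' => A u) this).symm
  unfold OneForm.d
  -- The exterior derivative commutes with pull-back by the `C²` map `F`.
  rw [key.extDeriv_eq, extDeriv_pullback hθ' hF (by simp), hFx, hm, hm]
  simp only [ContinuousAlternatingMap.compContinuousLinearMap_apply]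
  congr 1
  ext i
  fin_cases i <;> rfl

theorem extDeriv_linearForm {θ : E → E →L[ℝ] ℝ} {x : E} (hθ : DifferentiableAt ℝ θ x) (a b : E) :
    extDeriv (fun y => linearForm E (θ y)) x ![a, b] = fderiv ℝ θ x a b - fderiv ℝ θ x b a := by
  have hθ' : DifferentiableAt ℝ (fun y => linearForm E (θ y)) x :=
    (linearForm E).differentiableAt.comp _ hθ
  have h : ∀ c : E, fderiv ℝ (fun y => θ y c) x = (fderiv ℝ θ x).flip c := by
    intro c
    ext d
    rw [fderiv_clm_apply hθ (by fun_prop)]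
    simp
  rw [extDeriv_apply hθ']
  simp [Fin.sum_univ_two, linearForm_apply, Fin.removeNth, h, sub_eq_add_neg]

end Pullback

/-! ### Natural coordinates on `⊕ᵏT*Q × ℝᵏ` and their smoothness -/

section HamCoords

variable {n k : ℕ} {Q : Type*} [TopologicalSpace Q] [ChartedSpace (R n) Q]
  [IsManifold (𝓡 n) ∞ Q]
  {E : Type*} [NormedAddCommGroup E] [NormedSpace ℝ E]
  {H : Type*} [TopologicalSpace H] {I : ModelWithCorners ℝ E H}
  {M : Type*} [TopologicalSpace M] [ChartedSpace H M]

theorem contMDiff_ham_proj :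
    ContMDiff (hamModel n k) (𝓡 n) ∞ (fun z : HamSpace n k Q => z.1.proj) :=
  (contMDiff_proj (Mom n k Q)).comp contMDiff_fst

/-- The momenta are homomorphisms into a trivial bundle, so only their argument, a tangent vector of
`Q`, has to be trivialized. -/
theorem contMDiffAt_ham_iff {f : M → HamSpace n k Q} {x : M} :
    ContMDiffAt I (hamModel n k) ∞ f x ↔
      ContMDiffAt I (𝓡 n) ∞ (fun y => (f y).1.proj) x ∧
      ContMDiffAt I 𝓘(ℝ, R n →L[ℝ] R k) ∞ (fun y => ((f y).1.snd ∘L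
        (trivializationAt (R n) (TangentSpace (𝓡 n)) (f x).1.proj).symmL ℝ (f y).1.proj :
          R n →L[ℝ] R k)) x ∧
      ContMDiffAt I 𝓘(ℝ, R k) ∞ (fun y => (f y).2) x := by
  rw [contMDiffAt_prod_iff]
  simp only [Function.comp_def]
  rw [contMDiffAt_hom_bundle, and_assoc]
  refine and_congr_right fun _ => and_congr_left fun _ => ?_
  apply iff_of_eq
  congr 1
  ext y u
  simp [ContinuousLinearMap.inCoordinates]

variable {e : OpenPartialHomeomorph Q (R n)}

theorem mdifferentiable_of_mem_maximalAtlas (he : e ∈ IsManifold.maximalAtlas (𝓡 n) ∞ Q) :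
    e.MDifferentiable (𝓡 n) (𝓡 n) :=
  ⟨(contMDiffOn_of_mem_maximalAtlas he).mdifferentiableOn (by simp),
    (contMDiffOn_symm_of_mem_maximalAtlas he).mdifferentiableOn (by simp)⟩

theorem isInvertible_mvfderiv (he : e ∈ IsManifold.maximalAtlas (𝓡 n) ∞ Q) {q : Q}
    (hq : q ∈ e.source) : (mvfderiv (𝓡 n) e q).IsInvertible :=
  ⟨(mdifferentiable_of_mem_maximalAtlas he).mfderiv hq, rfl⟩

/-- Such a field is the pull-back by the chart of a constant field on `ℝⁿ`; for `v` a basis vector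
it is `∂/∂q^i`, and its pairing with the momenta gives the coordinates `p_i^α`. -/
theorem contMDiffAt_coordField (he : e ∈ IsManifold.maximalAtlas (𝓡 n) ∞ Q) {q : Q}
    (hq : q ∈ e.source) (v : R n) :
    ContMDiffAt (𝓡 n) (𝓡 n).tangent ∞
      (fun y => (⟨y, (mvfderiv (𝓡 n) e y).inverse v⟩ : TangentBundle (𝓡 n) Q)) q := by
  have hV : ContMDiffAt (𝓡 n) (𝓡 n).tangent ∞
      (fun y => (⟨y, v⟩ : TangentBundle (𝓡 n) (R n))) (e q) :=
    contMDiffAt_vectorSpace_iff_contDiffAt.2 contDiffAt_const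
  exact ContMDiffAt.mpullback_vectorField_preimage (n := ∞) hV
    (contMDiffAt_of_mem_maximalAtlas he hq) (isInvertible_mvfderiv he hq) (by simp)

theorem mvfderiv_inverse_apply (he : e ∈ IsManifold.maximalAtlas (𝓡 n) ∞ Q) {q : Q}
    (hq : q ∈ e.source) (v : R n) : mvfderiv (𝓡 n) e q ((mvfderiv (𝓡 n) e q).inverse v) = v := by
  obtain ⟨A, hA⟩ := isInvertible_mvfderiv he hq
  rw [← hA, ContinuousLinearMap.inverse_equiv]
  exact A.apply_symm_apply v

theorem inverse_mvfderiv_apply (he : e ∈ IsManifold.maximalAtlas (𝓡 n) ∞ Q) {q : Q}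
    (hq : q ∈ e.source) (u : TangentSpace (𝓡 n) q) :
    (mvfderiv (𝓡 n) e q).inverse (mvfderiv (𝓡 n) e q u) = u := by
  obtain ⟨A, hA⟩ := isInvertible_mvfderiv he hq
  rw [← hA, ContinuousLinearMap.inverse_equiv]
  exact A.symm_apply_apply u

theorem contMDiffAt_mom_apply {z : HamSpace n k Q} {X : (q : Q) → TangentSpace (𝓡 n) q}
    (hX : ContMDiffAt (𝓡 n) (𝓡 n).tangent ∞
      (fun y => (⟨y, X y⟩ : TangentBundle (𝓡 n) Q)) z.1.proj) :
    ContMDiffAt (hamModel n k) 𝓘(ℝ, R k) ∞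
      (fun y : HamSpace n k Q => (y.1.snd (X y.1.proj) : R k)) z := by
  have h1 : ContMDiffAt (hamModel n k) ((𝓡 n).prod 𝓘(ℝ, R n →L[ℝ] R k)) ∞
      (fun y : HamSpace n k Q =>
        (⟨y.1.proj, y.1.snd⟩ : TotalSpace (R n →L[ℝ] R k) (Mom n k Q))) z :=
    contMDiffAt_fst
  have h2 : ContMDiffAt (hamModel n k) ((𝓡 n).prod 𝓘(ℝ, R n)) ∞
      (fun y : HamSpace n k Q =>
        (⟨y.1.proj, X y.1.proj⟩ : TotalSpace (R n) (TangentSpace (𝓡 n) (M := Q)))) z :=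
    ContMDiffAt.comp z (g := fun y => (⟨y, X y⟩ : TangentBundle (𝓡 n) Q)) hX
      contMDiff_ham_proj.contMDiffAt
  exact (contMDiffAt_totalSpace.1 (h1.clm_bundle_apply h2)).2

theorem contMDiffAt_natCoords (he : e ∈ IsManifold.maximalAtlas (𝓡 n) ∞ Q)
    {z : HamSpace n k Q} (hz : z.1.proj ∈ e.source) :
    ContMDiffAt (hamModel n k) 𝓘(ℝ, Coords n k) ∞ (natCoords e) z := by
  have hprod {m : ℕ} {f : HamSpace n k Q → R m}
      (hf : ContMDiffAt (hamModel n k) 𝓘(ℝ, R m) ∞ f z) (i : Fin m) :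
      ContMDiffAt (hamModel n k) 𝓘(ℝ, ℝ) ∞ (fun y => f y i) z :=
    (EuclideanSpace.proj i : R m →L[ℝ] ℝ).contMDiff.contMDiffAt.comp z hf
  refine ContMDiffAt.prodMk_space (contMDiffAt_pi_space.2 fun i => hprod ?_ i)
    (ContMDiffAt.prodMk_space (contMDiffAt_pi_space.2 fun α => contMDiffAt_pi_space.2 fun i =>
      hprod ?_ α) (contMDiffAt_pi_space.2 fun α => hprod contMDiffAt_snd α))
  · exact ContMDiffAt.comp z (contMDiffAt_of_mem_maximalAtlas he hz)
      contMDiff_ham_proj.contMDiffAt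
  · exact contMDiffAt_mom_apply (contMDiffAt_coordField he hz _)

/-- The momentum `p^α = p_i^α dq^i` at `q`. -/
def coordMom (e : OpenPartialHomeomorph Q (R n)) (p : Fin k → Fin n → ℝ) (q : Q) : Mom n k Q q :=
  ∑ α, ∑ i, p α i • ((EuclideanSpace.proj i : R n →L[ℝ] ℝ) ∘L
    mvfderiv (𝓡 n) e q).smulRight (basisVec α : R k)

theorem natPoint_eq (e : OpenPartialHomeomorph Q (R n)) (c : Coords n k) :
    natPoint e c = ((⟨e.symm (WithLp.toLp 2 c.1), coordMom e c.2.1 (e.symm (WithLp.toLp 2 c.1))⟩,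
      WithLp.toLp 2 c.2.2) : HamSpace n k Q) := rfl

theorem coordMom_apply (p : Fin k → Fin n → ℝ) (q : Q) (u : TangentSpace (𝓡 n) q) (α : Fin k) :
    (coordMom e p q u : R k) α = ∑ i, p α i * (mvfderiv (𝓡 n) e q u) i := by
  have h : (coordMom e p q u : R k) =
      ∑ α, ∑ i, p α i • (mvfderiv (𝓡 n) e q u) i • (basisVec α : R k) := by
    unfold coordMom
    simp only [sum_apply]
    rfl
  rw [h]
  simp only [WithLp.ofLp_sum, WithLp.ofLp_smul, Finset.sum_apply, Pi.smul_apply, smul_eq_mul]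
  simp [basisVec]

theorem mom_apply_eq_sum (he : e ∈ IsManifold.maximalAtlas (𝓡 n) ∞ Q) {z : HamSpace n k Q}
    (hz : z.1.proj ∈ e.source) (u : TangentSpace (𝓡 n) z.1.proj) (α : Fin k) :
    (z.1.snd u : R k) α = ∑ i, (natCoords e z).2.1 α i * (mvfderiv (𝓡 n) e z.1.proj u) i := by
  set w : R n := mvfderiv (𝓡 n) e z.1.proj u with hw
  have h1 : w = ∑ i, w i • (basisVec i : R n) := by
    ext j
    simp [basisVec, Pi.single_apply]
  have h2 : u = ∑ i, w i • (mvfderiv (𝓡 n) e z.1.proj).inverse (basisVec i : R n) := by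
    conv_lhs => rw [← inverse_mvfderiv_apply he hz u, ← hw, h1]
    rw [map_sum]
    simp only [map_smul]
  have h3 : (z.1.snd u : R k) = ∑ i, w i • (z.1.snd
      ((mvfderiv (𝓡 n) e z.1.proj).inverse (basisVec i : R n)) : R k) := by
    conv_lhs => rw [h2]
    rw [map_sum]
    simp only [map_smul]
  rw [h3]
  simp [natCoords, mul_comm]

theorem natPoint_natCoords (he : e ∈ IsManifold.maximalAtlas (𝓡 n) ∞ Q)
    {z : HamSpace n k Q} (hz : z.1.proj ∈ e.source) : natPoint e (natCoords e z) = z := by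
  have h1 : e.symm (WithLp.toLp 2 (natCoords e z).1) = z.1.proj := e.left_inv hz
  have h2 : coordMom e (natCoords e z).2.1 z.1.proj = z.1.snd := by
    ext u α
    rw [coordMom_apply, mom_apply_eq_sum he hz]
  rw [natPoint_eq, h1, h2]
  rfl

theorem natCoords_natPoint (he : e ∈ IsManifold.maximalAtlas (𝓡 n) ∞ Q)
    {c : Coords n k} (hc : WithLp.toLp 2 c.1 ∈ e.target) : natCoords e (natPoint e c) = c := by
  rw [natPoint_eq, natCoords]
  refine Prod.ext ?_ (Prod.ext ?_ rfl)
  · simp [e.right_inv hc]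
  · ext α i
    dsimp only
    rw [coordMom_apply, mvfderiv_inverse_apply he (e.map_target hc)]
    simp [basisVec]

theorem contMDiffAt_natPoint (he : e ∈ IsManifold.maximalAtlas (𝓡 n) ∞ Q)
    {c : Coords n k} (hc : WithLp.toLp 2 c.1 ∈ e.target) :
    ContMDiffAt 𝓘(ℝ, Coords n k) (hamModel n k) ∞ (natPoint e) c := by
  set q : Coords n k → Q := fun y => e.symm (WithLp.toLp 2 y.1) with hq
  have htoLp {m : ℕ} : ContDiff ℝ ∞ (fun v : Fin m → ℝ => (WithLp.toLp 2 v : R m)) :=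
    (EuclideanSpace.equiv (Fin m) ℝ).symm.contDiff
  have h1 : ContMDiffAt 𝓘(ℝ, Coords n k) 𝓘(ℝ, R n) ∞
      (fun y : Coords n k => (WithLp.toLp 2 y.1 : R n)) c :=
    (htoLp.comp contDiff_fst).contDiffAt.contMDiffAt
  have hqs : ContMDiffAt 𝓘(ℝ, Coords n k) (𝓡 n) ∞ q c :=
    ContMDiffAt.comp c (contMDiffAt_symm_of_mem_maximalAtlas he hc) h1
  have hec : q c ∈ e.source := e.map_target hc
  refine contMDiffAt_ham_iff.2 ⟨hqs, ?_, ?_⟩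
  · set φ := extChartAt (𝓡 n) (q c) with hφ
    have hφc : φ.symm (φ (q c)) = q c := extChartAt_to_inv (q c)
    -- In the trivialization of `TQ` at `q c`, the differential of `e` is the ordinary derivative of
    -- this transition map, so smoothness of the momenta becomes a question on vector spaces.
    set κ : R n → R n := e ∘ φ.symm with hκ
    have hκs : ContDiffAt ℝ ∞ κ (φ (q c)) := by
      refine ContMDiffAt.contDiffAt (ContMDiffAt.comp (I' := 𝓡 n) _ ?_ ?_)
      · rw [hφc]
        exact contMDiffAt_of_mem_maximalAtlas he hec
      · exact (contMDiffOn_extChartAt_symm (q c)).contMDiffAt (extChartAt_target_mem_nhds (q c))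
    have hA : ContDiffAt ℝ ∞ (fun y => fderiv ℝ κ (φ (q y))) c := by
      refine ContMDiffAt.contDiffAt ?_
      exact ContMDiffAt.comp c (g := fun x => fderiv ℝ κ x)
        (hκs.fderiv_right (m := ∞) (by simp)).contMDiffAt
        (ContMDiffAt.comp c contMDiffAt_extChartAt hqs)
    have hev : ∀ᶠ y in nhds c, q y ∈ e.source ∧ q y ∈ φ.source :=
      hqs.continuousAt.eventually
        (Filter.inter_mem (e.open_source.mem_nhds hec) (extChartAt_source_mem_nhds (q c)))
    have hB : ContDiffAt ℝ ∞ (fun y : Coords n k => ∑ α, ∑ i, y.2.1 α i •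
        ((EuclideanSpace.proj i : R n →L[ℝ] ℝ) ∘L
          fderiv ℝ κ (φ (q y))).smulRight (basisVec α : R k)) c := by
      refine ContDiffAt.sum fun α _ => ContDiffAt.sum fun i _ => ?_
      have hp : ContDiffAt ℝ ∞ (fun y : Coords n k => y.2.1 α i) c := by fun_prop
      have hs : ContDiffAt ℝ ∞ (fun y => ((EuclideanSpace.proj i : R n →L[ℝ] ℝ) ∘L
          fderiv ℝ κ (φ (q y))).smulRight (basisVec α : R k)) c :=
        (contDiffAt_const.clm_comp hA).smulRight contDiffAt_const
      exact hp.smul hs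
    refine hB.contMDiffAt.congr_of_eventuallyEq ?_
    filter_upwards [hev] with y hy
    have hy2 : q y ∈ (chartAt (R n) (q c)).source := by simpa [hφ] using hy.2
    have hsymm : φ.symm (φ (q y)) = q y := φ.left_inv hy.2
    have hd : ∀ v : R n, fderiv ℝ κ (φ (q y)) v = mvfderiv (𝓡 n) e (q y)
        ((trivializationAt (R n) (TangentSpace (𝓡 n)) (q c)).symmL ℝ (q y) v) := by
      intro v
      rw [TangentBundle.symmL_trivializationAt hy2, modelWithCornersSelf_coe, range_id,
        mfderivWithin_univ]
      have hd1 : MDifferentiableAt (𝓡 n) (𝓡 n) e (q y) :=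
        (mdifferentiable_of_mem_maximalAtlas he).mdifferentiableAt hy.1
      have hd2 : MDifferentiableAt 𝓘(ℝ, R n) (𝓡 n) φ.symm (φ (q y)) :=
        ((contMDiffOn_extChartAt_symm (n := ∞) (q c)).contMDiffAt
          ((isOpen_extChartAt_target (q c)).mem_nhds (φ.map_source hy.2))).mdifferentiableAt
          (by simp)
      have := mfderiv_comp_apply_of_eq (φ (q y)) hd1 hd2 hsymm v
      rw [mfderiv_eq_fderiv] at this
      exact this
    ext v β
    have e1 : ((coordMom e y.2.1 (q y) ∘L (trivializationAt (R n) (TangentSpace (𝓡 n))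
        (q c)).symmL ℝ (q y) : R n →L[ℝ] R k) v) β =
        ∑ i, y.2.1 β i * (fderiv ℝ κ (φ (q y)) v) i := by
      rw [hd v]
      exact coordMom_apply _ _ _ _
    refine e1.trans ?_
    simp [sum_apply, basisVec, Pi.single_apply]
  · exact (htoLp.comp (contDiff_snd.comp contDiff_snd)).contDiffAt.contMDiffAt

end HamCoords

/-! ### The model contact forms on the coordinate space -/

section ContactForm

variable {n k : ℕ}

/-- The coordinate `q^i` as a linear form. -/
def coordQ (i : Fin n) : Coords n k →L[ℝ] ℝ :=
  ContinuousLinearMap.proj (R := ℝ) (φ := fun _ : Fin n => ℝ) i ∘L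
    ContinuousLinearMap.fst ℝ _ _

/-- The coordinate `p_i^α` as a linear form. -/
def coordP (i : Fin n) (α : Fin k) : Coords n k →L[ℝ] ℝ :=
  ContinuousLinearMap.proj (R := ℝ) (φ := fun _ : Fin n => ℝ) i ∘L
    ContinuousLinearMap.proj (R := ℝ) (φ := fun _ : Fin k => Fin n → ℝ) α ∘L
    ContinuousLinearMap.fst ℝ _ _ ∘L ContinuousLinearMap.snd ℝ _ _

/-- The coordinate `s^α` as a linear form. -/
def coordS (α : Fin k) : Coords n k →L[ℝ] ℝ :=
  ContinuousLinearMap.proj (R := ℝ) (φ := fun _ : Fin k => ℝ) α ∘L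
    ContinuousLinearMap.snd ℝ _ _ ∘L ContinuousLinearMap.snd ℝ _ _

@[simp] theorem coordQ_apply (i : Fin n) (c : Coords n k) : coordQ i c = c.1 i := rfl

@[simp] theorem coordP_apply (i : Fin n) (α : Fin k) (c : Coords n k) :
    coordP i α c = c.2.1 α i := rfl

@[simp] theorem coordS_apply (α : Fin k) (c : Coords n k) : coordS α c = c.2.2 α := rfl

/-- The form `ds^α - p_i^α dq^i` on the coordinate space. -/
def contactForm (α : Fin k) (c : Coords n k) : Coords n k →L[ℝ] ℝ :=
  coordS α - ∑ i, coordP i α c • coordQ i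

theorem contactForm_apply (α : Fin k) (c b : Coords n k) :
    contactForm α c b = b.2.2 α - ∑ i, c.2.1 α i * b.1 i := by
  simp [contactForm, sum_apply]

theorem differentiable_contactForm (α : Fin k) :
    Differentiable ℝ (contactForm (n := n) α) := by
  unfold contactForm
  fun_prop

theorem fderiv_contactForm (α : Fin k) (c a b : Coords n k) :
    fderiv ℝ (contactForm α) c a b = - ∑ i, a.2.1 α i * b.1 i := by
  have h1 : fderiv ℝ (fun c => contactForm α c b) c a = fderiv ℝ (contactForm α) c a b := by
    rw [fderiv_clm_apply (differentiable_contactForm α c) (by fun_prop)]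
    simp
  rw [← h1]
  -- With `b` fixed, the value of the form is affine in the base point, with linear part `-B`.
  let B : Coords n k →L[ℝ] ℝ := ∑ i, b.1 i • coordP i α
  have h2 : (fun c => contactForm α c b) = fun c => b.2.2 α - B c := by
    ext c
    simp [contactForm_apply, B, sum_apply, mul_comm]
  rw [h2, fderiv_const_sub, B.fderiv]
  simp [B, sum_apply, mul_comm]

theorem extDeriv_contactForm (α : Fin k) (c a b : Coords n k) :
    extDeriv (fun y => linearForm (Coords n k) (contactForm α y)) c ![a, b] =
      ∑ i, (b.2.1 α i * a.1 i - a.2.1 α i * b.1 i) := by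
  rw [extDeriv_linearForm (differentiable_contactForm α c), fderiv_contactForm,
    fderiv_contactForm, Finset.sum_sub_distrib]
  ring

end ContactForm

/-! ### The `k`-contact structure of `⊕ᵏT*Q × ℝᵏ` in natural coordinates -/

section HamForms

variable {E : Type*} [NormedAddCommGroup E] [NormedSpace ℝ E]
  {H : Type*} [TopologicalSpace H] {I : ModelWithCorners ℝ E H}
  {M : Type*} [TopologicalSpace M] [ChartedSpace H M]
  {E' E'' : Type*} [NormedAddCommGroup E'] [NormedSpace ℝ E']
  [NormedAddCommGroup E''] [NormedSpace ℝ E'']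

theorem mvfderiv_clm_comp {g : M → E'} {x : M} (hg : MDifferentiableAt I 𝓘(ℝ, E') g x)
    (A : E' →L[ℝ] E'') (u : TangentSpace I x) :
    mvfderiv I (fun y => A (g y)) x u = A (mvfderiv I g x u) := by
  have := mfderiv_comp_apply (I := I) (I' := 𝓘(ℝ, E')) (I'' := 𝓘(ℝ, E'')) x
    A.mdifferentiableAt hg u
  rw [mfderiv_eq_fderiv, A.fderiv] at this
  exact this

variable {n k : ℕ} {Q : Type*} [TopologicalSpace Q] [ChartedSpace (R n) Q]
  [IsManifold (𝓡 n) ∞ Q] {e : OpenPartialHomeomorph Q (R n)}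

theorem mvfderiv_natCoords_fst (he : e ∈ IsManifold.maximalAtlas (𝓡 n) ∞ Q)
    {z : HamSpace n k Q} (hz : z.1.proj ∈ e.source) (u : TangentSpace (hamModel n k) z)
    (i : Fin n) :
    (mvfderiv (hamModel n k) (natCoords e) z u).1 i = (mvfderiv (𝓡 n) e z.1.proj
      (mfderiv (hamModel n k) (𝓡 n) (fun z' : HamSpace n k Q => z'.1.proj) z u)) i := by
  have hn : MDifferentiableAt (hamModel n k) 𝓘(ℝ, Coords n k) (natCoords e) z :=
    (contMDiffAt_natCoords he hz).mdifferentiableAt (by simp)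
  have hπ : MDifferentiableAt (hamModel n k) (𝓡 n) (fun z' : HamSpace n k Q => z'.1.proj) z :=
    contMDiff_ham_proj.contMDiffAt.mdifferentiableAt (by simp)
  have he' : MDifferentiableAt (𝓡 n) (𝓡 n) e z.1.proj :=
    (mdifferentiable_of_mem_maximalAtlas he).mdifferentiableAt hz
  have h1 := mvfderiv_clm_comp hn (coordQ i) u
  have h2 := mvfderiv_clm_comp (I := hamModel n k) (he'.comp z hπ)
    (EuclideanSpace.proj i : R n →L[ℝ] ℝ) u
  have h3 := mfderiv_comp_apply z he' hπ u
  refine h1.symm.trans (h2.trans ?_)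
  exact congrArg (fun v : R n => v i) h3

theorem mvfderiv_natCoords_snd_snd (he : e ∈ IsManifold.maximalAtlas (𝓡 n) ∞ Q)
    {z : HamSpace n k Q} (hz : z.1.proj ∈ e.source) (u : TangentSpace (hamModel n k) z)
    (α : Fin k) :
    (mvfderiv (hamModel n k) (natCoords e) z u).2.2 α =
      mvfderiv (hamModel n k) (fun z' : HamSpace n k Q => z'.2 α) z u := by
  have hn : MDifferentiableAt (hamModel n k) 𝓘(ℝ, Coords n k) (natCoords e) z :=
    (contMDiffAt_natCoords he hz).mdifferentiableAt (by simp)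
  exact (mvfderiv_clm_comp hn (coordS α) u).symm

theorem etaHam_apply (he : e ∈ IsManifold.maximalAtlas (𝓡 n) ∞ Q)
    {z : HamSpace n k Q} (hz : z.1.proj ∈ e.source) (α : Fin k)
    (u : TangentSpace (hamModel n k) z) :
    etaHam α z u =
      contactForm α (natCoords e z) (mvfderiv (hamModel n k) (natCoords e) z u) := by
  rw [contactForm_apply, mvfderiv_natCoords_snd_snd he hz]
  have h : theta α z u = (z.1.snd (mfderiv (hamModel n k) (𝓡 n)
    (fun z' : HamSpace n k Q => z'.1.proj) z u) : R k) α := rfl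
  change _ - theta α z u = _
  rw [h, mom_apply_eq_sum he hz]
  simp only [mvfderiv_natCoords_fst he hz]
  rfl

theorem eventually_proj_mem {z : HamSpace n k Q} (hz : z.1.proj ∈ e.source) :
    ∀ᶠ y : HamSpace n k Q in nhds z, y.1.proj ∈ e.source :=
  contMDiff_ham_proj.continuous.continuousAt.eventually (e.open_source.mem_nhds hz)

/-- Near `z` the form `η^α` is the pull-back of the model form by the natural coordinates, whence
`dη^α = dq^i ∧ dp_i^α`. -/
theorem d_etaHam (he : e ∈ IsManifold.maximalAtlas (𝓡 n) ∞ Q)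
    {z : HamSpace n k Q} (hz : z.1.proj ∈ e.source) (α : Fin k)
    (u v : TangentSpace (hamModel n k) z) {a b : Coords n k}
    (ha : mvfderiv (hamModel n k) (natCoords e) z u = a)
    (hb : mvfderiv (hamModel n k) (natCoords e) z v = b) :
    OneForm.d (hamModel n k) (etaHam α) z u v =
      ∑ i, (b.2.1 α i * a.1 i - a.2.1 α i * b.1 i) := by
  rw [OneForm.d_of_eventuallyEq (etaHam α) (contactForm α) (natCoords e)
    (differentiable_contactForm α _) (contMDiffAt_natCoords he hz), ha, hb, extDeriv_contactForm]
  filter_upwards [eventually_proj_mem hz] with y hy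
  ext u
  exact etaHam_apply he hy α u

section Coordinates

variable (he : e ∈ IsManifold.maximalAtlas (𝓡 n) ∞ Q) {z : HamSpace n k Q}
  (hz : z.1.proj ∈ e.source)
include he hz

theorem natCoords_mem : WithLp.toLp 2 (natCoords e z).1 ∈ e.target := e.map_source hz

theorem mdifferentiableAt_natCoords :
    MDifferentiableAt (hamModel n k) 𝓘(ℝ, Coords n k) (natCoords e) z :=
  (contMDiffAt_natCoords he hz).mdifferentiableAt (by simp)

theorem mdifferentiableAt_natPoint :
    MDifferentiableAt 𝓘(ℝ, Coords n k) (hamModel n k) (natPoint e) (natCoords e z) :=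
  (contMDiffAt_natPoint he (natCoords_mem he hz)).mdifferentiableAt (by simp)

/-- Differentiating `natCoords ∘ natPoint = id` provides the preimage. Surjectivity allows
identities between forms to be tested on arbitrary coordinate vectors. -/
theorem mvfderiv_natCoords_surjective :
    Function.Surjective (mvfderiv (hamModel n k) (natCoords e) z) := by
  intro b
  have h0 := natPoint_natCoords he hz
  have h1 : natCoords e ∘ natPoint e =ᶠ[nhds (natCoords e z)] id := by
    have hc : ContinuousAt (fun c : Coords n k => (WithLp.toLp 2 c.1 : R n)) (natCoords e z) := by
      fun_prop
    filter_upwards [hc.eventually (e.open_target.mem_nhds (natCoords_mem he hz))] with c hc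
    exact natCoords_natPoint he hc
  have h2 := h1.mfderiv_eq (I := 𝓘(ℝ, Coords n k)) (I' := 𝓘(ℝ, Coords n k))
  have h3 := mfderiv_comp_apply_of_eq (natCoords e z) (mdifferentiableAt_natCoords he hz)
    (mdifferentiableAt_natPoint he hz) h0 b
  rw [h2, mfderiv_id] at h3
  exact ⟨_, h3.symm⟩

theorem mvfderiv_natCoords_injective :
    Function.Injective (mvfderiv (hamModel n k) (natCoords e) z) := by
  have h1 : natPoint e ∘ natCoords e =ᶠ[nhds z] id := by
    filter_upwards [eventually_proj_mem hz] with y hy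
    exact natPoint_natCoords he hy
  have h2 := h1.mfderiv_eq (I := hamModel n k) (I' := hamModel n k)
  have h4 : ∀ u : TangentSpace (hamModel n k) z,
      mfderiv 𝓘(ℝ, Coords n k) (hamModel n k) (natPoint e) (natCoords e z)
        (mvfderiv (hamModel n k) (natCoords e) z u) = u := by
    intro u
    have h3 := mfderiv_comp_apply z (mdifferentiableAt_natPoint he hz)
      (mdifferentiableAt_natCoords he hz) u
    rw [h2, mfderiv_id] at h3
    exact h3.symm
  intro u v huv
  rw [← h4 u, huv, h4 v]

theorem fderiv_comp_natPoint {h : HamSpace n k Q → ℝ}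
    (hh : MDifferentiableAt (hamModel n k) 𝓘(ℝ, ℝ) h z) (u : TangentSpace (hamModel n k) z) :
    fderiv ℝ (fun c => h (natPoint e c)) (natCoords e z)
      (mvfderiv (hamModel n k) (natCoords e) z u) = mvfderiv (hamModel n k) h z u := by
  have h0 := natPoint_natCoords he hz
  have h1 : (h ∘ natPoint e) ∘ natCoords e =ᶠ[nhds z] h := by
    filter_upwards [eventually_proj_mem hz] with y hy
    exact congrArg h (natPoint_natCoords he hy)
  have hd : MDifferentiableAt 𝓘(ℝ, Coords n k) 𝓘(ℝ, ℝ) (h ∘ natPoint e) (natCoords e z) :=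
    MDifferentiableAt.comp (natCoords e z) (by rwa [h0]) (mdifferentiableAt_natPoint he hz)
  have h2 := h1.mfderiv_eq (I := hamModel n k) (I' := 𝓘(ℝ, ℝ))
  have h3 := mfderiv_comp_apply z hd (mdifferentiableAt_natCoords he hz) u
  rw [mfderiv_eq_fderiv] at h3
  refine Eq.trans h3.symm ?_
  exact congrArg (fun A : ((R n × (R n →L[ℝ] R k)) × R k) →L[ℝ] ℝ => A u) h2

/-- This is the uniqueness of the Reeb fields. The conditions on `dη^β` remove the `q` and `p`
components, after which `η^β(u)` is the `s^β` component. The hypotheses concern a single vector, so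
they also apply to a vector projected from any point of a fibre of `ρ₂`. -/
theorem mvfderiv_natCoords_reeb {α : Fin k} {u : TangentSpace (hamModel n k) z}
    (h1 : ∀ β, etaHam β z u = if α = β then 1 else 0)
    (h2 : ∀ β v, OneForm.d (hamModel n k) (etaHam β) z u v = 0) :
    mvfderiv (hamModel n k) (natCoords e) z u = dirS n α := by
  set a := mvfderiv (hamModel n k) (natCoords e) z u with ha
  have h3 : ∀ (β : Fin k) (b : Coords n k),
      ∑ i, (b.2.1 β i * a.1 i - a.2.1 β i * b.1 i) = 0 := by
    intro β b
    obtain ⟨v, hv⟩ := mvfderiv_natCoords_surjective he hz b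
    rw [← d_etaHam he hz β u v ha.symm hv]
    exact h2 β v
  -- Contraction with `∂/∂p_j^α` isolates `dq^j(u)`; below, `∂/∂q^j` isolates `dp_j^β(u)`.
  have hq : ∀ j, a.1 j = 0 := by
    intro j
    simpa [dirP, Pi.single_apply] using h3 α (dirP j α)
  have hp : ∀ β j, a.2.1 β j = 0 := by
    intro β j
    simpa [dirQ, Pi.single_apply] using h3 β (dirQ k j)
  refine Prod.ext (funext hq) (Prod.ext (funext fun β => funext (hp β)) (funext fun β => ?_))
  have := h1 β
  rw [etaHam_apply he hz, contactForm_apply, ← ha] at this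
  simpa [hq, dirS, Pi.single_apply, eq_comm] using this

end Coordinates

end HamForms

/-! ### The extended Pontryagin bundle and the submersion `ρ₂` -/

section Pontryagin

variable {n k : ℕ} {Q : Type*} [TopologicalSpace Q] [ChartedSpace (R n) Q]
  [IsManifold (𝓡 n) ∞ Q]
  {E : Type*} [NormedAddCommGroup E] [NormedSpace ℝ E]
  {H : Type*} [TopologicalSpace H] {I : ModelWithCorners ℝ E H}
  {M : Type*} [TopologicalSpace M] [ChartedSpace H M]

/-- `𝓦` is a fibre product, so smoothness into it is tested on the two projections. -/
theorem contMDiffAt_pont_iff {f : M → Pontryagin n k Q} {x : M} :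
    ContMDiffAt I (pontModel n k) ∞ f x ↔
      ContMDiffAt I (lagModel n k) ∞ (fun y => rho1 (f y)) x ∧
      ContMDiffAt I (hamModel n k) ∞ (fun y => rho2 (f y)) x := by
  rw [contMDiffAt_prod_iff, contMDiffAt_prod_iff, contMDiffAt_prod_iff]
  simp only [Function.comp_def, rho1, rho2]
  rw [contMDiffAt_totalSpace, contMDiffAt_totalSpace, contMDiffAt_totalSpace]
  have : ContMDiffAt I 𝓘(ℝ, (R k →L[ℝ] R n) × (R n →L[ℝ] R k)) ∞
      (fun y => (trivializationAt ((R k →L[ℝ] R n) × (R n →L[ℝ] R k))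
        (Vel n k Q ×ᵇ Mom n k Q) (f x).1.proj (f y).1).2) x ↔
      ContMDiffAt I 𝓘(ℝ, R k →L[ℝ] R n) ∞ (fun y => (trivializationAt (R k →L[ℝ] R n)
        (Vel n k Q) (f x).1.proj ⟨(f y).1.proj, (f y).1.2.1⟩).2) x ∧
      ContMDiffAt I 𝓘(ℝ, R n →L[ℝ] R k) ∞ (fun y => (trivializationAt (R n →L[ℝ] R k)
        (Mom n k Q) (f x).1.proj ⟨(f y).1.proj, (f y).1.2.2⟩).2) x :=
    contMDiffAt_prod_module_iff _
  rw [this]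
  tauto

theorem contMDiffAt_lag_iff {f : M → LagSpace n k Q} {x : M} :
    ContMDiffAt I (lagModel n k) ∞ f x ↔
      ContMDiffAt I (𝓡 n) ∞ (fun y => (f y).1.proj) x ∧
      ContMDiffAt I 𝓘(ℝ, R k →L[ℝ] R n) ∞ (fun y =>
        ((trivializationAt (R n) (TangentSpace (𝓡 n)) (f x).1.proj).continuousLinearMapAt ℝ
          (f y).1.proj ∘L (f y).1.snd : R k →L[ℝ] R n)) x ∧
      ContMDiffAt I 𝓘(ℝ, R k) ∞ (fun y => (f y).2) x := by
  rw [contMDiffAt_prod_iff]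
  simp only [Function.comp_def]
  rw [contMDiffAt_hom_bundle, and_assoc]
  refine and_congr_right fun _ => and_congr_left fun _ => ?_
  apply iff_of_eq
  congr 1
  ext y u
  simp [ContinuousLinearMap.inCoordinates]

theorem contMDiff_rho1 : ContMDiff (pontModel n k) (lagModel n k) ∞
    (rho1 : Pontryagin n k Q → LagSpace n k Q) :=
  fun _ => (contMDiffAt_pont_iff.1 contMDiffAt_id).1

theorem contMDiff_rho2 : ContMDiff (pontModel n k) (hamModel n k) ∞
    (rho2 : Pontryagin n k Q → HamSpace n k Q) :=
  fun _ => (contMDiffAt_pont_iff.1 contMDiffAt_id).2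

theorem mdifferentiableAt_rho2 (w : Pontryagin n k Q) :
    MDifferentiableAt (pontModel n k) (hamModel n k) rho2 w :=
  (contMDiff_rho2 w).mdifferentiableAt (by simp)

theorem contMDiff_coupling :
    ContMDiff (pontModel n k) 𝓘(ℝ, ℝ) ∞ (coupling : Pontryagin n k Q → ℝ) := by
  intro w
  have hv : ContMDiffAt (pontModel n k) ((𝓡 n).prod 𝓘(ℝ, R k →L[ℝ] R n)) ∞
      (fun y : Pontryagin n k Q =>
        (⟨y.1.proj, y.1.snd.1⟩ : TotalSpace (R k →L[ℝ] R n) (Vel n k Q))) w :=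
    contMDiffAt_fst.comp w (contMDiff_rho1 w)
  have hp : ContMDiffAt (pontModel n k) ((𝓡 n).prod 𝓘(ℝ, R n →L[ℝ] R k)) ∞
      (fun y : Pontryagin n k Q =>
        (⟨y.1.proj, y.1.snd.2⟩ : TotalSpace (R n →L[ℝ] R k) (Mom n k Q))) w :=
    contMDiffAt_fst.comp w (contMDiff_rho2 w)
  have hb : ContMDiffAt (pontModel n k) (𝓡 n) ∞ (fun y : Pontryagin n k Q => y.1.proj) w :=
    contMDiff_ham_proj.contMDiffAt.comp w (contMDiff_rho2 w)
  refine ContMDiffAt.sum fun α _ => ?_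
  have hc : ContMDiffAt (pontModel n k) ((𝓡 n).prod 𝓘(ℝ, R k)) ∞
      (fun y : Pontryagin n k Q =>
        (⟨y.1.proj, (basisVec α : R k)⟩ : TotalSpace (R k) (Trivial Q (R k)))) w :=
    contMDiffAt_totalSpace.2 ⟨hb, contMDiffAt_const⟩
  have h := (contMDiffAt_totalSpace.1 (hp.clm_bundle_apply (hv.clm_bundle_apply hc))).2
  exact (EuclideanSpace.proj α : R k →L[ℝ] ℝ).contMDiff.contMDiffAt.comp w h

theorem contMDiff_pontHamiltonian {L : LagSpace n k Q → ℝ}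
    (hL : ContMDiff (lagModel n k) 𝓘(ℝ, ℝ) ∞ L) :
    ContMDiff (pontModel n k) 𝓘(ℝ, ℝ) ∞ (pontHamiltonian L) :=
  contMDiff_coupling.sub (hL.comp contMDiff_rho1)

/-- The coordinate `s^α` of `𝓦` factors through `ρ₂`, as `Θ^α` does by definition, so `η^α` on `𝓦`
is the pull-back of `η^α` downstairs. -/
theorem etaPont_apply (α : Fin k) (w : Pontryagin n k Q) (U : TangentSpace (pontModel n k) w) :
    etaPont α w U =
      etaHam α (rho2 w) (mfderiv (pontModel n k) (hamModel n k) rho2 w U) := by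
  have hs : MDifferentiableAt (hamModel n k) 𝓘(ℝ, ℝ) (fun z : HamSpace n k Q => z.2 α) (rho2 w) :=
    ((EuclideanSpace.proj α : R k →L[ℝ] ℝ).contMDiff.contMDiffAt.comp (rho2 w)
      (contMDiffAt_snd (n := ∞))).mdifferentiableAt (by simp)
  have h := mvfderiv_comp_apply w hs (mdifferentiableAt_rho2 w) U
  exact congrArg (fun t : ℝ => t - ThetaPont α w U) h

theorem mvfderiv_natCoords_rho2 {e : OpenPartialHomeomorph Q (R n)}
    (he : e ∈ IsManifold.maximalAtlas (𝓡 n) ∞ Q) {w : Pontryagin n k Q}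
    (hw : (rho2 w).1.proj ∈ e.source) (U : TangentSpace (pontModel n k) w) :
    mvfderiv (pontModel n k) (fun y => natCoords e (rho2 y)) w U =
      mvfderiv (hamModel n k) (natCoords e) (rho2 w)
        (mfderiv (pontModel n k) (hamModel n k) rho2 w U) :=
  mfderiv_comp_apply w (mdifferentiableAt_natCoords he hw) (mdifferentiableAt_rho2 w) U

theorem etaPont_eq_contactForm {e : OpenPartialHomeomorph Q (R n)}
    (he : e ∈ IsManifold.maximalAtlas (𝓡 n) ∞ Q) {w : Pontryagin n k Q}
    (hw : (rho2 w).1.proj ∈ e.source) (α : Fin k) :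
    etaPont α w = (contactForm α (natCoords e (rho2 w))).comp
      (mvfderiv (pontModel n k) (fun y => natCoords e (rho2 y)) w) := by
  ext U
  rw [etaPont_apply, etaHam_apply he hw, ← mvfderiv_natCoords_rho2 he hw]
  rfl

/-- The map `natCoords e ∘ ρ₂` is not a chart of `𝓦`, but the pull-back formula for `d` requires
only smoothness. -/
theorem d_etaPont_eq {e : OpenPartialHomeomorph Q (R n)}
    (he : e ∈ IsManifold.maximalAtlas (𝓡 n) ∞ Q) {w : Pontryagin n k Q}
    (hw : (rho2 w).1.proj ∈ e.source) (α : Fin k) (U V : TangentSpace (pontModel n k) w) :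
    OneForm.d (pontModel n k) (etaPont α) w U V =
      extDeriv (fun y => linearForm (Coords n k) (contactForm α y)) (natCoords e (rho2 w))
        ![mvfderiv (pontModel n k) (fun y => natCoords e (rho2 y)) w U,
          mvfderiv (pontModel n k) (fun y => natCoords e (rho2 y)) w V] := by
  refine OneForm.d_of_eventuallyEq (etaPont α) (contactForm α) (fun y => natCoords e (rho2 y))
    (differentiable_contactForm α _)
    ((contMDiffAt_natCoords he hw).comp w (contMDiff_rho2 w)) ?_ U V
  filter_upwards [contMDiff_rho2.continuous.continuousAt.eventually (eventually_proj_mem hw)]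
    with y hy
  exact etaPont_eq_contactForm he hy α

theorem d_etaPont (α : Fin k) (w : Pontryagin n k Q) (U V : TangentSpace (pontModel n k) w) :
    OneForm.d (pontModel n k) (etaPont α) w U V =
      OneForm.d (hamModel n k) (etaHam α) (rho2 w)
        (mfderiv (pontModel n k) (hamModel n k) rho2 w U)
        (mfderiv (pontModel n k) (hamModel n k) rho2 w V) := by
  have he := IsManifold.chart_mem_maximalAtlas (I := 𝓡 n) (n := ∞) (rho2 w).1.proj
  have hw : (rho2 w).1.proj ∈ (chartAt (R n) (rho2 w).1.proj).source := mem_chart_source _ _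
  rw [d_etaHam he hw α _ _ (mvfderiv_natCoords_rho2 he hw U).symm
    (mvfderiv_natCoords_rho2 he hw V).symm, d_etaPont_eq he hw, extDeriv_contactForm]

/-- The point of `𝓦` over `z` whose velocities have the components `a` in the trivialization
of `TQ` at `q₀`. -/
def velSection (q₀ : Q) (z : HamSpace n k Q) (a : R k →L[ℝ] R n) : Pontryagin n k Q :=
  (⟨z.1.proj, ((trivializationAt (R n) (TangentSpace (𝓡 n)) q₀).symmL ℝ z.1.proj ∘L a,
    z.1.snd)⟩, z.2)

/-- The components of the velocities of `w` in the trivialization of `TQ` at `q₀`. -/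
def velComponents (q₀ : Q) (w : Pontryagin n k Q) : R k →L[ℝ] R n :=
  (trivializationAt (R n) (TangentSpace (𝓡 n)) q₀).continuousLinearMapAt ℝ w.1.proj ∘L w.1.snd.1

theorem eventually_mem_baseSet (z : HamSpace n k Q) :
    ∀ᶠ y : HamSpace n k Q in nhds z,
      y.1.proj ∈ (trivializationAt (R n) (TangentSpace (𝓡 n) (M := Q)) z.1.proj).baseSet :=
  contMDiff_ham_proj.continuous.continuousAt.eventually
    ((trivializationAt (R n) (TangentSpace (𝓡 n) (M := Q)) z.1.proj).open_baseSet.mem_nhds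
      (mem_baseSet_trivializationAt _ _ _))

theorem contMDiffAt_velSection (z : HamSpace n k Q) (a : R k →L[ℝ] R n) :
    ContMDiffAt ((hamModel n k).prod 𝓘(ℝ, R k →L[ℝ] R n)) (pontModel n k) ∞
      (fun x : HamSpace n k Q × (R k →L[ℝ] R n) => velSection z.1.proj x.1 x.2) (z, a) := by
  refine contMDiffAt_pont_iff.2 ⟨contMDiffAt_lag_iff.2 ⟨?_, ?_, ?_⟩, contMDiffAt_fst⟩
  · exact contMDiff_ham_proj.contMDiffAt.comp (z, a) contMDiffAt_fst
  · refine (contMDiffAt_snd (I := hamModel n k) (M := HamSpace n k Q)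
      (J := 𝓘(ℝ, R k →L[ℝ] R n)) (N := R k →L[ℝ] R n)).congr_of_eventuallyEq ?_
    filter_upwards [continuousAt_fst.eventually (eventually_mem_baseSet z)] with x hx
    ext v : 1
    exact Trivialization.continuousLinearMapAt_symmL _ hx _
  · have h : ContMDiffAt (hamModel n k) 𝓘(ℝ, R k) ∞ (fun y : HamSpace n k Q => y.2) z :=
      contMDiffAt_snd
    exact ContMDiffAt.comp (z, a) (f := (Prod.fst : HamSpace n k Q × (R k →L[ℝ] R n) → _))
      h contMDiffAt_fst

theorem contMDiffAt_velComponents (w : Pontryagin n k Q) :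
    ContMDiffAt (pontModel n k) 𝓘(ℝ, R k →L[ℝ] R n) ∞ (velComponents w.1.proj) w :=
  (contMDiffAt_lag_iff.1 (contMDiff_rho1 w)).2.1

/-- Near `w`, the trivialization of `TQ` makes `𝓦` a product of `⊕ᵏT*Q × ℝᵏ` with the space of
velocity components. -/
theorem eventually_velSection_velComponents (w : Pontryagin n k Q) :
    ∀ᶠ y in nhds w, velSection w.1.proj (rho2 y) (velComponents w.1.proj y) = y := by
  filter_upwards [contMDiff_rho2.continuous.continuousAt.eventually
    (eventually_mem_baseSet (rho2 w))] with y hy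
  have h : (trivializationAt (R n) (TangentSpace (𝓡 n)) w.1.proj).symmL ℝ y.1.proj ∘L
      velComponents w.1.proj y = y.1.snd.1 := by
    ext v : 1
    exact Trivialization.symmL_continuousLinearMapAt _ hy _
  obtain ⟨⟨q, v, p⟩, s⟩ := y
  exact congrArg (fun v' => ((⟨q, (v', p)⟩, s) : Pontryagin n k Q)) h

/-- Freezing the velocity components at their values at `w` gives a section of `ρ₂` through `w`,
smooth near `ρ₂ w`. -/
theorem mfderiv_rho2_surjective (w : Pontryagin n k Q) :
    Function.Surjective (mfderiv (pontModel n k) (hamModel n k) rho2 w) := by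
  intro u
  have h1 : velSection w.1.proj (rho2 w) (velComponents w.1.proj w) = w :=
    (eventually_velSection_velComponents w).self_of_nhds
  have h2 : MDifferentiableAt (hamModel n k) (pontModel n k)
      (fun z => velSection w.1.proj z (velComponents w.1.proj w)) (rho2 w) :=
    ContMDiffAt.mdifferentiableAt (n := ∞) ((contMDiffAt_velSection (rho2 w) _).comp (rho2 w)
      (contMDiffAt_id.prodMk contMDiffAt_const)) (by simp)
  have h3 := mfderiv_comp_apply_of_eq (rho2 w) (mdifferentiableAt_rho2 w) h2 h1 u
  have h4 : mfderiv (hamModel n k) (hamModel n k) (rho2 ∘ fun z : HamSpace n k Q =>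
      velSection w.1.proj z (velComponents w.1.proj w)) (rho2 w) u = u := by
    have : (rho2 ∘ fun z : HamSpace n k Q =>
      velSection w.1.proj z (velComponents w.1.proj w)) = id := rfl
    rw [this, mfderiv_id]
    rfl
  exact ⟨_, h3.symm.trans h4⟩

/-- The inclusion of the fibre of `rho2` at `w`. -/
def velInclusion (w : Pontryagin n k Q) (v : R k →L[ℝ] R n) : Pontryagin n k Q :=
  (⟨w.1.proj, (v, w.1.snd.2)⟩, w.2)

theorem contMDiff_velInclusion (w : Pontryagin n k Q) :
    ContMDiff 𝓘(ℝ, R k →L[ℝ] R n) (pontModel n k) ∞ (velInclusion w) := by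
  intro v
  refine contMDiffAt_pont_iff.2 ⟨contMDiffAt_lag_iff.2 ⟨contMDiffAt_const, ?_, contMDiffAt_const⟩,
    contMDiffAt_const (c := rho2 w)⟩
  let A : R n →L[ℝ] R n := (trivializationAt (R n) (TangentSpace (𝓡 n))
    w.1.proj).continuousLinearMapAt ℝ w.1.proj
  have h : ContDiff ℝ ∞ (fun v : R k →L[ℝ] R n => A ∘L v) := contDiff_const.clm_comp contDiff_id
  exact h.contDiffAt.contMDiffAt

theorem fibreDeriv_eq (L : LagSpace n k Q → ℝ) (w : Pontryagin n k Q) (b : R k →L[ℝ] R n) :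
    fderiv ℝ (fun v : R k →L[ℝ] R n => L (rho1 (velInclusion w v))) (w.1.snd.1 : R k →L[ℝ] R n) b =
      fibreDeriv L (rho1 w) b := rfl

end Pontryagin

/-! ### The kernel of `Tρ₂` -/

section Pontryagin

variable {n k : ℕ} {Q : Type*} [TopologicalSpace Q] [ChartedSpace (R n) Q]
  [IsManifold (𝓡 n) ∞ Q]
  {E : Type*} [NormedAddCommGroup E] [NormedSpace ℝ E]
  {H : Type*} [TopologicalSpace H] {I : ModelWithCorners ℝ E H}
  {M : Type*} [TopologicalSpace M] [ChartedSpace H M]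

theorem mdifferentiableAt_velSection (w : Pontryagin n k Q) :
    MDifferentiableAt ((hamModel n k).prod 𝓘(ℝ, R k →L[ℝ] R n)) (pontModel n k)
      (fun x : HamSpace n k Q × (R k →L[ℝ] R n) => velSection w.1.proj x.1 x.2)
      (rho2 w, velComponents w.1.proj w) :=
  (contMDiffAt_velSection (rho2 w) _).mdifferentiableAt (by simp)

theorem mfderiv_velSection_mfderiv (w : Pontryagin n k Q) (U : TangentSpace (pontModel n k) w) :
    mfderiv ((hamModel n k).prod 𝓘(ℝ, R k →L[ℝ] R n)) (pontModel n k)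
      (fun x : HamSpace n k Q × (R k →L[ℝ] R n) => velSection w.1.proj x.1 x.2)
      (rho2 w, velComponents w.1.proj w)
      (mfderiv (pontModel n k) ((hamModel n k).prod 𝓘(ℝ, R k →L[ℝ] R n))
        (fun y => (rho2 y, velComponents w.1.proj y)) w U) = U := by
  have hc : MDifferentiableAt (pontModel n k) 𝓘(ℝ, R k →L[ℝ] R n) (velComponents w.1.proj) w :=
    (contMDiffAt_velComponents w).mdifferentiableAt (by simp)
  have h3 := mfderiv_comp_apply w (mdifferentiableAt_velSection w)
    ((mdifferentiableAt_rho2 w).prodMk hc) U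
  have h4 := Filter.EventuallyEq.mfderiv_eq (I := pontModel n k) (I' := pontModel n k)
    (f := id)
    (f₁ := (fun x : HamSpace n k Q × (R k →L[ℝ] R n) => velSection w.1.proj x.1 x.2) ∘
      fun y => (rho2 y, velComponents w.1.proj y))
      (eventually_velSection_velComponents w)
  rw [h4, mfderiv_id] at h3
  exact h3.symm

theorem mfderiv_prodMk_rho2 {w : Pontryagin n k Q} {U : TangentSpace (pontModel n k) w}
    (hU : mfderiv (pontModel n k) (hamModel n k) rho2 w U = 0) :
    ∃ b : R k →L[ℝ] R n,
      mfderiv (pontModel n k) ((hamModel n k).prod 𝓘(ℝ, R k →L[ℝ] R n))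
        (fun y => (rho2 y, velComponents w.1.proj y)) w U =
      ((0, b) : ((R n × (R n →L[ℝ] R k)) × R k) × (R k →L[ℝ] R n)) := by
  have hc : MDifferentiableAt (pontModel n k) 𝓘(ℝ, R k →L[ℝ] R n) (velComponents w.1.proj) w :=
    (contMDiffAt_velComponents w).mdifferentiableAt (by simp)
  refine ⟨mfderiv (pontModel n k) 𝓘(ℝ, R k →L[ℝ] R n) (velComponents w.1.proj) w U, ?_⟩
  rw [mfderiv_prodMk (mdifferentiableAt_rho2 w) hc]
  exact Prod.ext hU rfl

theorem exists_mfderiv_velSection (w : Pontryagin n k Q) (b : R k →L[ℝ] R n) :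
    ∃ b' : R k →L[ℝ] R n,
    mfderiv ((hamModel n k).prod 𝓘(ℝ, R k →L[ℝ] R n)) (pontModel n k)
      (fun x : HamSpace n k Q × (R k →L[ℝ] R n) => velSection w.1.proj x.1 x.2)
      (rho2 w, velComponents w.1.proj w)
      ((0, b) : ((R n × (R n →L[ℝ] R k)) × R k) × (R k →L[ℝ] R n)) =
    mfderiv 𝓘(ℝ, R k →L[ℝ] R n) (pontModel n k) (velInclusion w)
      (w.1.snd.1 : R k →L[ℝ] R n) b' := by
  set S : R n →L[ℝ] R n :=
    (trivializationAt (R n) (TangentSpace (𝓡 n)) w.1.proj).symmL ℝ w.1.proj with hS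
  set a₀ : R k →L[ℝ] R n := velComponents w.1.proj w with ha₀
  have hSa : S ∘L a₀ = (w.1.snd.1 : R k →L[ℝ] R n) := by
    ext v : 1
    exact Trivialization.symmL_continuousLinearMapAt _ (mem_baseSet_trivializationAt _ _ _) _
  have hr : MDifferentiableAt 𝓘(ℝ, R k →L[ℝ] R n) ((hamModel n k).prod 𝓘(ℝ, R k →L[ℝ] R n))
      (fun a : R k →L[ℝ] R n => (rho2 w, a)) a₀ :=
    mdifferentiableAt_const.prodMk mdifferentiableAt_id
  -- The curve of points over `ρ₂ w` with components `a` is also `velInclusion w (S ∘L a)`; `h5` and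
  -- `h6` are the chain rule for the two factorizations, which gives `b' = S ∘L b`.
  have h5 := mfderiv_comp_apply a₀ (mdifferentiableAt_velSection w) hr b
  rw [mfderiv_prod_right] at h5
  have hSd : HasFDerivAt (fun a : R k →L[ℝ] R n => S ∘L a)
      (ContinuousLinearMap.compL ℝ (R k) (R n) (R n) S) a₀ :=
    (ContinuousLinearMap.compL ℝ (R k) (R n) (R n) S).hasFDerivAt
  have h6 := mfderiv_comp_apply_of_eq (I := 𝓘(ℝ, R k →L[ℝ] R n))
    (I' := 𝓘(ℝ, R k →L[ℝ] R n)) a₀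
    ((contMDiff_velInclusion w _).mdifferentiableAt (by simp))
    hSd.differentiableAt.mdifferentiableAt hSa b
  rw [mfderiv_eq_fderiv, hSd.fderiv] at h6
  exact ⟨S ∘L b, h5.symm.trans h6⟩

/-- In the local product structure a vector killed by `Tρ₂` has only velocity components, hence is
tangent to the fibre. -/
theorem exists_mfderiv_velInclusion {w : Pontryagin n k Q} {U : TangentSpace (pontModel n k) w}
    (hU : mfderiv (pontModel n k) (hamModel n k) rho2 w U = 0) :
    ∃ b : R k →L[ℝ] R n, U = mfderiv 𝓘(ℝ, R k →L[ℝ] R n) (pontModel n k) (velInclusion w)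
      (w.1.snd.1 : R k →L[ℝ] R n) b := by
  obtain ⟨b, hb⟩ := mfderiv_prodMk_rho2 hU
  obtain ⟨b', hb'⟩ := exists_mfderiv_velSection w b
  refine ⟨b', ?_⟩
  rw [← hb', ← hb, mfderiv_velSection_mfderiv]

end Pontryagin

/-- A linear form vanishing on `ker T` and agreeing with `dh ∘ T` on the range of a map `G` with
`T ∘ G` surjective equals `dh ∘ T`. -/
theorem apply_eq_of_graph {A V W : Type*} [AddCommGroup A] [TopologicalSpace A] [Module ℝ A]
    [AddCommGroup V] [TopologicalSpace V] [Module ℝ V]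
    [AddCommGroup W] [TopologicalSpace W] [Module ℝ W]
    {T : V →L[ℝ] W} {G : A →L[ℝ] V} {dH : V →L[ℝ] ℝ} {dh : W →L[ℝ] ℝ}
    (hsurj : ∀ u, ∃ a, T (G a) = u) (hG : ∀ a, dH (G a) = dh (T (G a)))
    (hker : ∀ v, T v = 0 → dH v = 0) (v : V) : dH v = dh (T v) := by
  obtain ⟨a, ha⟩ := hsurj (T v)
  have h1 := hker (v - G a) (by rw [map_sub, ha, sub_self])
  rw [map_sub, sub_eq_zero] at h1
  rw [h1, hG, ha]

/-! ### The Legendre graph and the differential of `𝓗` along it -/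

section Legendre

variable {n k : ℕ} {Q : Type*} [TopologicalSpace Q] [ChartedSpace (R n) Q]
  [IsManifold (𝓡 n) ∞ Q] {L : LagSpace n k Q → ℝ}

theorem sum_inclVel (q : Q) (v : Vel n k Q q) :
    ∑ α, inclVel q α (v (basisVec α : R k)) = v := by
  have hv : ∀ x : R k, v x = ∑ α, x α • v (basisVec α : R k) := by
    intro x
    have hx : x = ∑ α, x α • (basisVec α : R k) := by
      ext j
      simp [basisVec, Pi.single_apply]
    conv_lhs => rw [hx]
    rw [map_sum]
    simp only [map_smul]
  refine ContinuousLinearMap.ext fun x => ?_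
  rw [sum_apply, hv x]
  rfl

/-- With momenta `𝓕L(x)`, the coupling is the linear form `∂L/∂v` at `x`. Leaving `v` free serves
twice: `v = x.1.snd` yields `𝓗 = E_L` on the graph, and varying `v` yields the derivative of `𝓗`
along the fibre. -/
theorem sum_legendre_apply (L : LagSpace n k Q → ℝ) (x : LagSpace n k Q)
    (v : Vel n k Q x.1.proj) :
    ∑ α, ((legendre L x).1.snd (v (basisVec α : R k)) : R k) α = fibreDeriv L x v := by
  have h : ∀ (u : TangentSpace (𝓡 n) x.1.proj) (α : Fin k),
      ((legendre L x).1.snd u : R k) α = fibreDeriv L x (inclVel x.1.proj α u) := by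
    intro u α
    have h1 : ((legendre L x).1.snd u : R k) =
        ∑ β, fibreDeriv L x (inclVel x.1.proj β u) • (basisVec β : R k) := by
      unfold legendre
      simp only [sum_apply]
      rfl
    rw [h1]
    simp [basisVec, Pi.single_apply]
  simp only [h]
  rw [← map_sum, sum_inclVel]

/-- The parametrization of the graph of the Legendre map by `⊕ᵏTQ × ℝᵏ`. -/
def legendreGraph (L : LagSpace n k Q → ℝ) (x : LagSpace n k Q) : Pontryagin n k Q :=
  (⟨x.1.proj, (x.1.snd, (legendre L x).1.snd)⟩, x.2)

theorem eq_legendreGraph {w : Pontryagin n k Q} (hw : w ∈ firstConstraint L) :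
    w = legendreGraph L (rho1 w) := by
  obtain ⟨⟨q, v, p⟩, s⟩ := w
  have h : rho2 ((⟨q, (v, p)⟩, s) : Pontryagin n k Q) =
    legendre L (rho1 ((⟨q, (v, p)⟩, s) : Pontryagin n k Q)) := hw
  have h1 := congrArg Prod.fst h
  injection h1 with _ h2
  exact congrArg (fun p' => ((⟨q, (v, p')⟩, s) : Pontryagin n k Q)) h2

theorem contMDiff_legendreGraph (hreg : IsRegularLagrangian L) :
    ContMDiff (lagModel n k) (pontModel n k) ∞ (legendreGraph L) :=
  fun x => contMDiffAt_pont_iff.2 ⟨contMDiffAt_id, IsLocalDiffeomorph.contMDiff hreg x⟩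

theorem pontHamiltonian_legendreGraph (x : LagSpace n k Q) :
    pontHamiltonian L (legendreGraph L x) = lagEnergy L x :=
  congrArg (fun r => r - L x) (sum_legendre_apply L x x.1.snd)

/-- Writing `E_L` as `𝓗` on the graph reduces its smoothness to that of `𝓗` and of `𝓕L`, the latter
being part of regularity. -/
theorem contMDiff_lagEnergy (hL : ContMDiff (lagModel n k) 𝓘(ℝ, ℝ) ∞ L)
    (hreg : IsRegularLagrangian L) : ContMDiff (lagModel n k) 𝓘(ℝ, ℝ) ∞ (lagEnergy L) := by
  have h : lagEnergy L = pontHamiltonian L ∘ legendreGraph L :=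
    funext fun x => (pontHamiltonian_legendreGraph x).symm
  rw [h]
  exact (contMDiff_pontHamiltonian hL).comp (contMDiff_legendreGraph hreg)

/-- With the momenta held at `𝓕L(x)`, the function `𝓗` on the fibre is `ℓ v - L(q, v, s)`, where `ℓ`
is exactly the derivative of `L` in `v` at `x`, so the two contributions cancel. -/
theorem mvfderiv_pontHamiltonian_velInclusion (hL : ContMDiff (lagModel n k) 𝓘(ℝ, ℝ) ∞ L)
    (x : LagSpace n k Q) (b : R k →L[ℝ] R n) :
    mvfderiv (pontModel n k) (pontHamiltonian L) (legendreGraph L x)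
      (mfderiv 𝓘(ℝ, R k →L[ℝ] R n) (pontModel n k) (velInclusion (legendreGraph L x))
        (x.1.snd : R k →L[ℝ] R n) b) = 0 := by
  let v₀ : R k →L[ℝ] R n := x.1.snd
  let ℓ : (R k →L[ℝ] R n) →L[ℝ] ℝ := fibreDeriv L x
  have hι := contMDiff_velInclusion (legendreGraph L x) v₀
  have hd : DifferentiableAt ℝ
      (fun v : R k →L[ℝ] R n => L (rho1 (velInclusion (legendreGraph L x) v))) v₀ :=
    (ContMDiffAt.contDiffAt ((hL.comp contMDiff_rho1).contMDiffAt.comp v₀ hι)).differentiableAt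
      (by simp)
  have h1 : (pontHamiltonian L ∘ velInclusion (legendreGraph L x)) =
      fun v : R k →L[ℝ] R n => ℓ v - L (rho1 (velInclusion (legendreGraph L x) v)) :=
    funext fun v => congrArg (fun r => r - L (rho1 (velInclusion (legendreGraph L x) v)))
      (sum_legendre_apply L x v)
  have h2 := mvfderiv_comp_apply (I' := 𝓘(ℝ, R k →L[ℝ] R n)) v₀
    (((contMDiff_pontHamiltonian hL) (velInclusion (legendreGraph L x) v₀)).mdifferentiableAt
      (by simp))
    (hι.mdifferentiableAt (by simp)) b
  have h3 : fderiv ℝ (pontHamiltonian L ∘ velInclusion (legendreGraph L x)) v₀ b = 0 := by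
    rw [h1, fderiv_fun_sub ℓ.differentiableAt hd, ℓ.fderiv]
    have := fibreDeriv_eq L (legendreGraph L x) b
    exact sub_eq_zero.2 this.symm
  rw [← mfderiv_eq_fderiv] at h3
  exact h2.symm.trans h3

/-- The equality `𝓗 = h ∘ ρ₂` is known only on `𝓦₁`, yet the differentials agree on all tangent
vectors of `𝓦` there: the graph directions come from `E_L = h ∘ 𝓕L`, the fibre directions contribute
zero on both sides, and regularity makes these span. -/
theorem mvfderiv_pontHamiltonian (hL : ContMDiff (lagModel n k) 𝓘(ℝ, ℝ) ∞ L)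
    (hreg : IsRegularLagrangian L) {h : HamSpace n k Q → ℝ} {x : LagSpace n k Q}
    (hh : MDifferentiableAt (hamModel n k) 𝓘(ℝ, ℝ) h (legendre L x))
    (hE : lagEnergy L =ᶠ[nhds x] h ∘ legendre L)
    (V : TangentSpace (pontModel n k) (legendreGraph L x)) :
    mvfderiv (pontModel n k) (pontHamiltonian L) (legendreGraph L x) V =
      mvfderiv (hamModel n k) h (legendre L x)
        (mfderiv (pontModel n k) (hamModel n k) rho2 (legendreGraph L x) V) := by
  have hFL : MDifferentiableAt (lagModel n k) (hamModel n k) (legendre L) x :=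
    (hreg x).mdifferentiableAt (by simp)
  have hγ : MDifferentiableAt (lagModel n k) (pontModel n k) (legendreGraph L) x :=
    (contMDiff_legendreGraph hreg x).mdifferentiableAt (by simp)
  have hH : MDifferentiableAt (pontModel n k) 𝓘(ℝ, ℝ) (pontHamiltonian L) (legendreGraph L x) :=
    (contMDiff_pontHamiltonian hL _).mdifferentiableAt (by simp)
  have hcomp : ∀ a, mfderiv (lagModel n k) (hamModel n k) (legendre L) x a =
      mfderiv (pontModel n k) (hamModel n k) rho2 (legendreGraph L x)
        (mfderiv (lagModel n k) (pontModel n k) (legendreGraph L) x a) :=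
    fun a => mfderiv_comp_apply x (mdifferentiableAt_rho2 _) hγ a
  have hsurj : ∀ u, ∃ a, mfderiv (lagModel n k) (hamModel n k) (legendre L) x a = u :=
    ((hreg x).mfderivToContinuousLinearEquiv (by simp)).surjective
  have h5 : pontHamiltonian L ∘ legendreGraph L =ᶠ[nhds x] h ∘ legendre L :=
    Filter.EventuallyEq.trans
      (Filter.Eventually.of_forall pontHamiltonian_legendreGraph) hE
  refine apply_eq_of_graph
    (T := (mfderiv (pontModel n k) (hamModel n k) rho2 (legendreGraph L x) :
      ((R n × ((R k →L[ℝ] R n) × (R n →L[ℝ] R k))) × R k) →L[ℝ]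
        ((R n × (R n →L[ℝ] R k)) × R k)))
    (G := (mfderiv (lagModel n k) (pontModel n k) (legendreGraph L) x :
      ((R n × (R k →L[ℝ] R n)) × R k) →L[ℝ]
        ((R n × ((R k →L[ℝ] R n) × (R n →L[ℝ] R k))) × R k)))
    (dH := mvfderiv (pontModel n k) (pontHamiltonian L) (legendreGraph L x))
    (dh := mvfderiv (hamModel n k) h (legendre L x)) ?_ ?_ ?_ V
  · intro u
    obtain ⟨a, ha⟩ := hsurj u
    exact ⟨a, (hcomp a).symm.trans ha⟩
  · intro a
    have h3 : mvfderiv (lagModel n k) (pontHamiltonian L ∘ legendreGraph L) x a =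
        mvfderiv (pontModel n k) (pontHamiltonian L) (legendreGraph L x)
          (mfderiv (lagModel n k) (pontModel n k) (legendreGraph L) x a) :=
      mvfderiv_comp_apply x hH hγ a
    have h4 : mvfderiv (lagModel n k) (h ∘ legendre L) x a =
        mvfderiv (hamModel n k) h (legendre L x)
          (mfderiv (lagModel n k) (hamModel n k) (legendre L) x a) :=
      mvfderiv_comp_apply x hh hFL a
    have h6 : mvfderiv (lagModel n k) (pontHamiltonian L ∘ legendreGraph L) x a =
        mvfderiv (lagModel n k) (h ∘ legendre L) x a :=
      congrArg (fun A : ((R n × (R k →L[ℝ] R n)) × R k) →L[ℝ] ℝ => A a)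
        (h5.mfderiv_eq (I := lagModel n k) (I' := 𝓘(ℝ, ℝ)))
    rw [hcomp a] at h4
    exact h3.symm.trans (h6.trans h4)
  · intro U hU
    obtain ⟨b, hb⟩ := exists_mfderiv_velInclusion (w := legendreGraph L x) (U := U) hU
    rw [hb]
    exact mvfderiv_pontHamiltonian_velInclusion hL x b

end Legendre

/-! ### Projection of the field equations and their coordinate form -/

section FieldEquations

variable {n k : ℕ} {Q : Type*} [TopologicalSpace Q] [ChartedSpace (R n) Q]
  [IsManifold (𝓡 n) ∞ Q] {e : OpenPartialHomeomorph Q (R n)}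
  {L : LagSpace n k Q → ℝ} {h : HamSpace n k Q → ℝ}

/-- The zero velocities over a point of `⊕ᵏT*Q × ℝᵏ`. -/
def zeroVel (z : HamSpace n k Q) : Pontryagin n k Q := (⟨z.1.proj, (0, z.1.snd)⟩, z.2)

/-- The projection of a family of Reeb vector fields of `𝓦`. -/
def projReeb (Rb : Fin k → VField (pontModel n k) (Pontryagin n k Q)) (α : Fin k) :
    VField (hamModel n k) (HamSpace n k Q) := fun z =>
  mfderiv (pontModel n k) (hamModel n k) rho2 (zeroVel z) (Rb α (zeroVel z))

variable {Rb : Fin k → VField (pontModel n k) (Pontryagin n k Q)}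

theorem contract_mfderiv_rho2 (hRb : IsReebFamily (pontModel n k) etaPont Rb)
    (w : Pontryagin n k Q) (α β : Fin k) :
    etaHam β (rho2 w) (mfderiv (pontModel n k) (hamModel n k) rho2 w (Rb α w)) =
      if α = β then 1 else 0 := by
  rw [← etaPont_apply, hRb.contract]

theorem contract_d_mfderiv_rho2 (hRb : IsReebFamily (pontModel n k) etaPont Rb)
    (w : Pontryagin n k Q) (α β : Fin k) (u : TangentSpace (hamModel n k) (rho2 w)) :
    OneForm.d (hamModel n k) (etaHam β) (rho2 w)
      (mfderiv (pontModel n k) (hamModel n k) rho2 w (Rb α w)) u = 0 := by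
  obtain ⟨U, rfl⟩ := mfderiv_rho2_surjective w u
  rw [← d_etaPont, hRb.contract_d]

/-- The zero velocities select a point over each `z`, so the given family on `𝓦` itself supplies a
Reeb family downstairs. -/
theorem isReebFamily_projReeb (hRb : IsReebFamily (pontModel n k) etaPont Rb) :
    IsReebFamily (hamModel n k) etaHam (projReeb Rb) where
  contract z α β := contract_mfderiv_rho2 hRb (zeroVel z) α β
  contract_d z α β u := contract_d_mfderiv_rho2 hRb (zeroVel z) α β u

/-- The Reeb vectors at `w` and at the zero-velocity point of its fibre project to vectors
satisfying the same Reeb conditions, and these have a unique solution. -/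
theorem mfderiv_rho2_reeb (hRb : IsReebFamily (pontModel n k) etaPont Rb)
    (w : Pontryagin n k Q) (α : Fin k) :
    mfderiv (pontModel n k) (hamModel n k) rho2 w (Rb α w) = projReeb Rb α (rho2 w) := by
  set e := chartAt (R n) (rho2 w).1.proj
  have he : e ∈ IsManifold.maximalAtlas (𝓡 n) ∞ Q := IsManifold.chart_mem_maximalAtlas _
  have hz : (rho2 w).1.proj ∈ e.source := mem_chart_source _ _
  have hR := isReebFamily_projReeb hRb
  refine mvfderiv_natCoords_injective he hz ?_
  rw [mvfderiv_natCoords_reeb he hz (fun β => contract_mfderiv_rho2 hRb w α β)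
    (fun β u => contract_d_mfderiv_rho2 hRb w α β u),
    mvfderiv_natCoords_reeb he hz (fun β => hR.contract (rho2 w) α β)
    (fun β u => hR.contract_d (rho2 w) α β u)]

/-- Once `d𝓗 = ρ₂^* dh` at `w`, every term of the equations upstairs depends on its vectors only
through `Tρ₂`, and each vector downstairs has a lift. -/
theorem hdwAt_rho2 (hRb : IsReebFamily (pontModel n k) etaPont Rb) {w : Pontryagin n k Q}
    {𝓗 : Pontryagin n k Q → ℝ} {X : Fin k → TangentSpace (pontModel n k) w}
    (hX : HDWAt (pontModel n k) etaPont Rb 𝓗 w X)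
    (hd : ∀ U, mvfderiv (pontModel n k) 𝓗 w U = mvfderiv (hamModel n k) h (rho2 w)
      (mfderiv (pontModel n k) (hamModel n k) rho2 w U))
    (h0 : 𝓗 w = h (rho2 w)) :
    HDWAt (hamModel n k) etaHam (projReeb Rb) h (rho2 w)
      (fun α => mfderiv (pontModel n k) (hamModel n k) rho2 w (X α)) where
  first u := by
    obtain ⟨U, rfl⟩ := mfderiv_rho2_surjective w u
    have := hX.first U
    simp only [d_etaPont, hd, mfderiv_rho2_reeb hRb, etaPont_apply] at this
    exact this
  second := by
    have := hX.second
    simp only [etaPont_apply, h0] at this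
    exact this

theorem hdwAt_rho2_of_mem_firstConstraint (hL : ContMDiff (lagModel n k) 𝓘(ℝ, ℝ) ∞ L)
    (hreg : IsRegularLagrangian L) (hRb : IsReebFamily (pontModel n k) etaPont Rb)
    {U : Set (LagSpace n k Q)} (hU : IsOpen U) (hE : ∀ y ∈ U, lagEnergy L y = h (legendre L y))
    {w : Pontryagin n k Q} (hw : w ∈ firstConstraint L) (hwU : rho1 w ∈ U)
    (hh : MDifferentiableAt (hamModel n k) 𝓘(ℝ, ℝ) h (rho2 w))
    {X : Fin k → TangentSpace (pontModel n k) w}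
    (hX : HDWAt (pontModel n k) etaPont Rb (pontHamiltonian L) w X) :
    HDWAt (hamModel n k) etaHam (projReeb Rb) h (rho2 w)
      (fun α => mfderiv (pontModel n k) (hamModel n k) rho2 w (X α)) := by
  obtain ⟨x, rfl⟩ : ∃ x, w = legendreGraph L x := ⟨_, eq_legendreGraph hw⟩
  refine hdwAt_rho2 hRb hX (mvfderiv_pontHamiltonian hL hreg hh ?_) ?_
  · filter_upwards [hU.mem_nhds hwU] with y hy
    exact hE y hy
  · exact (pontHamiltonian_legendreGraph x).trans (hE x hwU)

/-- The first intrinsic equation is tested on `∂/∂p_i^α` and `∂/∂q^i`, giving the equations for `q`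
and `p`; the second, combined with the one for `q`, gives the equation for `s`. -/
theorem hdwCoordsAt_of_hdwAt (he : e ∈ IsManifold.maximalAtlas (𝓡 n) ∞ Q)
    {Rb : Fin k → VField (hamModel n k) (HamSpace n k Q)}
    (hRb : IsReebFamily (hamModel n k) etaHam Rb) {φ : R k → HamSpace n k Q} {t : R k}
    (ht : (φ t).1.proj ∈ e.source) (hφ : MDifferentiableAt 𝓘(ℝ, R k) (hamModel n k) φ t)
    (hh : MDifferentiableAt (hamModel n k) 𝓘(ℝ, ℝ) h (φ t))
    (hX : HDWAt (hamModel n k) etaHam Rb h (φ t) (partialVel (hamModel n k) φ t)) :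
    HDWCoordsAt e h φ t := by
  set c := natCoords e (φ t) with hc
  set f := fderiv ℝ (fun c => h (natPoint e c)) c with hf
  set a : Fin k → Coords n k := fun α =>
    mvfderiv (hamModel n k) (natCoords e) (φ t) (partialVel (hamModel n k) φ t α) with ha
  have hcoord : ∀ (A : Coords n k →L[ℝ] ℝ) (α : Fin k),
      fderiv ℝ (fun τ => A (natCoords e (φ τ))) t (basisVec α) = A (a α) := by
    intro A α
    have h1 := mfderiv_comp_apply t (mdifferentiableAt_natCoords he ht) hφ (basisVec α : R k)
    have hd : DifferentiableAt ℝ (natCoords e ∘ φ) t :=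
      ((mdifferentiableAt_natCoords he ht).comp t hφ).differentiableAt
    rw [mfderiv_eq_fderiv] at h1
    have h2 : fderiv ℝ (fun τ => A (natCoords e (φ τ))) t = A ∘L fderiv ℝ (natCoords e ∘ φ) t :=
      (A.hasFDerivAt.comp t hd.hasFDerivAt).fderiv
    rw [h2]
    exact congrArg A h1
  have hreeb : ∀ α, mvfderiv (hamModel n k) h (φ t) (Rb α (φ t)) = f (dirS n α) := by
    intro α
    rw [← fderiv_comp_natPoint he ht hh, mvfderiv_natCoords_reeb he ht (α := α)
      (fun β => hRb.contract _ α β) (fun β u => hRb.contract_d _ α β u)]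
  have hfirst : ∀ b : Coords n k,
      ∑ α, ∑ i, (b.2.1 α i * (a α).1 i - (a α).2.1 α i * b.1 i) =
        f b - ∑ α, f (dirS n α) * contactForm α c b := by
    intro b
    obtain ⟨u, hu⟩ := mvfderiv_natCoords_surjective he ht b
    have h1 := hX.first u
    simp only [hreeb, etaHam_apply he ht, hu] at h1
    rw [← fderiv_comp_natPoint he ht hh, hu] at h1
    rw [← h1]
    exact Finset.sum_congr rfl fun α _ => (d_etaHam he ht α _ u rfl hu).symm
  have hsecond : ∑ α, contactForm α c (a α) = - h (φ t) := by
    rw [← hX.second]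
    exact Finset.sum_congr rfl fun α _ => (etaHam_apply he ht α _).symm
  -- The contact forms vanish on `∂/∂p_i^α`, so the Reeb term drops out.
  have hq : ∀ i α, (a α).1 i = f (dirP i α) := by
    intro i α
    have := hfirst (dirP i α)
    simpa [dirP, contactForm_apply, Pi.single_apply, ite_apply] using this
  refine ⟨fun i α => ?_, fun i => ?_, ?_⟩
  · rw [← hf, ← hq]
    exact hcoord (coordQ i) α
  · have h1 := hfirst (dirQ k i)
    have h2 : ∀ α, fderiv ℝ (fun τ => (natCoords e (φ τ)).2.1 α i) t (basisVec α) =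
        (a α).2.1 α i := fun α => hcoord (coordP i α) α
    -- Here the Reeb term survives: `η^α(∂/∂q^i) = -p_i^α` produces `p_i^α ∂h/∂s^α`.
    have h3 : ∀ α, contactForm α c (dirQ k i) = - c.2.1 α i := by
      simp [contactForm_apply, dirQ, Pi.single_apply]
    have h4 : ∀ α : Fin k, ∑ j, ((dirQ k i).2.1 α j * (a α).1 j -
        (a α).2.1 α j * (dirQ k i).1 j) = - (a α).2.1 α i := by
      simp [dirQ, Pi.single_apply]
    simp only [h3, h4, mul_neg, Finset.sum_neg_distrib] at h1
    simp only [h2]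
    change _ = -(f (dirQ k i) + ∑ α, c.2.1 α i * f (dirS n α))
    simp only [mul_comm (c.2.1 _ i)]
    linarith
  · have h2 : ∀ α, fderiv ℝ (fun τ => (natCoords e (φ τ)).2.2 α) t (basisVec α) =
        (a α).2.2 α := fun α => hcoord (coordS α) α
    simp only [h2]
    change _ = (∑ α, ∑ i, c.2.1 α i * f (dirP i α)) - h (φ t)
    simp only [contactForm_apply, Finset.sum_sub_distrib, hq] at hsecond
    linarith

end FieldEquations

end KContact
end

/-! ### Local Hamiltonians and the Hamiltonian part of an integral section -/

theorem mainTheorem10 {n k : ℕ} {Q : Type*} [TopologicalSpace Q]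
    [ChartedSpace (EuclideanSpace ℝ (Fin n)) Q] [IsManifold (𝓡 n) ∞ Q]
    (L : KContact.LagSpace n k Q → ℝ)
    (hL : ContMDiff (KContact.lagModel n k) 𝓘(ℝ, ℝ) ∞ L)
    (hreg : KContact.IsRegularLagrangian L)
    (Rb : Fin k → KContact.VField (KContact.pontModel n k) (KContact.Pontryagin n k Q))
    (hRb : KContact.IsReebFamily (KContact.pontModel n k) KContact.etaPont Rb)
    (Z : Fin k → KContact.VField (KContact.pontModel n k) (KContact.Pontryagin n k Q))
    (hZ : ∀ w ∈ KContact.firstConstraint L,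
      KContact.HDWAt (KContact.pontModel n k) KContact.etaPont Rb
        (KContact.pontHamiltonian L) w (fun α => Z α w))
    (D : Set (EuclideanSpace ℝ (Fin k))) (hD : IsOpen D)
    (ψ : EuclideanSpace ℝ (Fin k) → KContact.Pontryagin n k Q)
    (hψ : KContact.IsIntegralSection (KContact.pontModel n k) Z ψ D)
    (hψW : MapsTo ψ D (KContact.firstConstraint L)) :
    -- locally, the Hamiltonian `h` exists
    (∀ x : KContact.LagSpace n k Q, ∃ U : Set (KContact.LagSpace n k Q),
      IsOpen U ∧ x ∈ U ∧ InjOn (KContact.legendre L) U ∧ IsOpen (KContact.legendre L '' U) ∧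
      ∃ h : KContact.HamSpace n k Q → ℝ,
        ContMDiffOn (KContact.hamModel n k) 𝓘(ℝ, ℝ) ∞ h (KContact.legendre L '' U) ∧
        ∀ y ∈ U, KContact.lagEnergy L y = h (KContact.legendre L y)) ∧
    -- for every such Hamiltonian, the Hamiltonian part of `ψ` solves its field equations
    (∀ (U : Set (KContact.LagSpace n k Q)) (h : KContact.HamSpace n k Q → ℝ),
      IsOpen U →
      ContMDiffOn (KContact.hamModel n k) 𝓘(ℝ, ℝ) ∞ h (KContact.legendre L '' U) →
      (∀ y ∈ U, KContact.lagEnergy L y = h (KContact.legendre L y)) →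
      KContact.IsHDWSolutionOn h (fun t => KContact.rho2 (ψ t))
        (D ∩ (fun t => KContact.rho1 (ψ t)) ⁻¹' U)) := by
  refine ⟨fun x => ?_, fun U h hU hh hE => ?_⟩
  · obtain ⟨Φ, hx, hΦ⟩ := hreg x
    have himage : KContact.legendre L '' Φ.source = Φ.target := by
      rw [hΦ.image_eq]
      exact Φ.toPartialEquiv.image_source_eq_target
    refine ⟨Φ.source, Φ.open_source, hx, ?_, by rw [himage]; exact Φ.open_target,
      -- The Hamiltonian is the energy transported by the local inverse `Φ⁻¹` of `𝓕L`; its values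
      -- off `𝓕L(U)` are irrelevant.
      KContact.lagEnergy L ∘ Φ.symm, ?_, fun y hy => ?_⟩
    · exact hΦ.injOn_iff.2 Φ.toPartialEquiv.injOn
    · rw [himage]
      exact (KContact.contMDiff_lagEnergy hL hreg).comp_contMDiffOn Φ.symm.contMDiffOn
    · rw [hΦ hy]
      exact congrArg (KContact.lagEnergy L) (Φ.toPartialEquiv.left_inv hy).symm
  -- Since `h` is smooth only on `𝓕L(U)`, openness of this image, which holds without injectivity of
  -- `𝓕L` on `U`, is what makes `h` differentiable at `ρ₂(ψ(t)) = 𝓕L(ρ₁(ψ(t)))`.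
  · have hopen : IsOpen (KContact.legendre L '' U) :=
      IsLocalDiffeomorph.isOpenMap hreg U hU
    have hψd : ∀ t ∈ D, MDifferentiableAt 𝓘(ℝ, EuclideanSpace ℝ (Fin k))
        (KContact.pontModel n k) ψ t := fun t ht =>
      (hψ.smooth.contMDiffAt (hD.mem_nhds ht)).mdifferentiableAt (by simp)
    have hhd : ∀ t ∈ D ∩ (fun t => KContact.rho1 (ψ t)) ⁻¹' U,
        MDifferentiableAt (KContact.hamModel n k) 𝓘(ℝ, ℝ) h (KContact.rho2 (ψ t)) := by
      intro t ht
      refine (hh.contMDiffAt (hopen.mem_nhds ?_)).mdifferentiableAt (by simp)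
      exact ⟨_, ht.2, (hψW ht.1).symm⟩
    have hX : ∀ t ∈ D ∩ (fun t => KContact.rho1 (ψ t)) ⁻¹' U,
        KContact.HDWAt (KContact.hamModel n k) KContact.etaHam (KContact.projReeb Rb) h
          (KContact.rho2 (ψ t))
          (KContact.partialVel (KContact.hamModel n k) (fun t => KContact.rho2 (ψ t)) t) := by
      intro t ht
      -- By the chain rule the velocities of `ρ₂ ∘ ψ` are the `Tρ₂`-images of `Z_α`.
      have hv : KContact.partialVel (KContact.hamModel n k) (fun t => KContact.rho2 (ψ t)) t =
          fun α => mfderiv (KContact.pontModel n k) (KContact.hamModel n k) KContact.rho2 (ψ t)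
            (Z α (ψ t)) := by
        funext α
        rw [← hψ.velocity t ht.1 α]
        exact mfderiv_comp_apply t (KContact.mdifferentiableAt_rho2 (ψ t)) (hψd t ht.1) _
      rw [hv]
      exact KContact.hdwAt_rho2_of_mem_firstConstraint hL hreg hRb hU hE (hψW ht.1) ht.2
        (hhd t ht) (hZ (ψ t) (hψW ht.1))
    refine ⟨KContact.contMDiff_rho2.comp_contMDiffOn (hψ.smooth.mono inter_subset_left),
      ⟨KContact.projReeb Rb, KContact.isReebFamily_projReeb hRb, hX⟩, fun e he t ht hte => ?_⟩
    exact KContact.hdwCoordsAt_of_hdwAt he (KContact.isReebFamily_projReeb hRb) hte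
      ((KContact.mdifferentiableAt_rho2 (ψ t)).comp t (hψd t ht.1)) (hhd t ht) (hX t ht)
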